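/- Write $\langle u,v\rangle_{\mathbb C^2}=\sum_j u_j\overline{v_j}$, $L^2=L^2(\mathbb R,\mathbb C^2)$, and $H^k=H^k(\mathbb R,\mathbb C^2)$ with $\|u\|_{H^k}^2=\sum_{j=0}^k\|\partial_x^ju\|_{L^2}^2$. Let $\sigma_0$ be the $2\times2$ identity matrix, $\sigma_1,\sigma_2,\sigma_3$ the Pauli matrices, and $\mathbf s\cdot\boldsymbol\sigma=\sum_{\alpha=0}^3 s_\alpha\sigma_\alpha$. Fix a smooth $\mathbf s=(s_0,s_1,s_2,s_3):\mathbb R\to\mathbb R^4$, a Hermitian $2\times 2$ matrix $\gamma$ and $g\in C^\infty(\mathbb R,\mathbb R)$. *Nonlinear quantum walk.* For $\delta>0$ and $u\in \mathcal H_\delta=\ell^2(\delta\mathbb Z,\mathbb C^2)$ put $(\mathcal S_\delta u)(x)=(u_1(x-\delta),u_2(x+\delta))$, $(\mathcal C_\delta u)(x)=e^{-i\delta\,\mathbf s(x)\cdot\boldsymbol\sigma}u(x)$, $(\mathcal N_\delta u)(x)=e^{-i\delta g(\langle u(x),\gamma u(x)\rangle_{\mathbb C^2})\gamma}u(x)$,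 and let $\mathcal U_\delta(0)u=u$, $\mathcal U_\delta(m+1)u=\mathcal S_\delta\mathcal C_\delta\mathcal N_\delta(\mathcal U_\delta(m)u)$. *Nonlinear Dirac equation (NLD).* A solution on $[0,T]$ with initial datum $u_0\in H^s$ is a function $u\in C([0,T],H^s)$ with $u(0)=u_0$ and $$ i\partial_tu=-i\sigma_3\partial_xu+\mathbf s\cdot\boldsymbol\sigma\,u+g(\langle u,\gamma u\rangle_{\mathbb C^2})\gamma u ;$$ it is denoted by $U_{\mathrm{Dirac}}(t)u_0$. The pair $(T,L)$ satisfies condition $(\mathrm{Lip})_s$ if there is $C>0$ such that for all $u_1,u_2\in H^s$ with $\|u_j\|_{H^s}\le L$ the solutions $U_{\mathrm{Dirac}}(\cdot)u_j\in C([0,T],H^s)$ exist and $\sup_{0\le t\le T}\|U_{\mathrm{Dirac}}(t)u_1-U_{\mathrm{Dirac}}(t)u_2\|_{H^s}\le C\|u_1-u_2\|_{H^s}$. *Shannon interpolation.* Let $F$ be the unitary Fourier transform $Fu(\xi)=\frac1{\sqrt{2\pi}}\int e^{-ix\xi}u(x)\,dx$ on $L^2$, let $j_\delta=F^{-1}\chi_{[-\pi/\delta,\pi/\delta]}F$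 be the projection of $L^2$ onto the space $H_\delta$ of the functions whose Fourier transform is supported in $[-\pi/\delta,\pi/\delta]$, and let $I_\delta:\mathcal H_\delta\to H_\delta$ be the bijection for which $F(I_\delta u)(\xi)=\frac{\delta}{\sqrt{2\pi}}\sum_{x\in\delta\mathbb Z}e^{-ix\xi}u(x)$ for $|\xi|\le\pi/\delta$ and $F(I_\delta u)(\xi)=0$ otherwise. **Statement.** Let $s\ge1$ be an integer and $T,L>0$. Assume $\|\mathbf s\|_{L^\infty}+\|\mathbf s'\|_{H^s(\mathbb R,\mathbb R^4)}<\infty$, that $(T,L)$ satisfies $(\mathrm{Lip})_s$, and that $u_0\in H^{s+1}$ with $\|u_0\|_{H^{s+1}}\le L$. Then $$\lim_{\delta\to0^+}\ \sup_{m\in\mathbb Z,\ 0\le m\delta\le T}\bigl\| I_\delta\circ\mathcal U_\delta(m)\circ I_\delta^{-1}\circ j_\delta u_0-U_{\mathrm{Dirac}}(m\delta)u_0\bigr\|_{L^2}=0 .$$ In particular (the case $g=0$) this covers the convergence of the linear quantum walk to the linear Dirac equation. -/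

import Mathlib

open MeasureTheory Filter Topology
open scoped ContDiff FourierTransform SchwartzMap LineDeriv

noncomputable section

namespace NLQW

/-- `ℂ²` with its Hermitian norm. -/
abbrev Spinor : Type := EuclideanSpace ℂ (Fin 2)

/-- `L² = L²(ℝ, ℂ²)`. -/
abbrev L2 : Type := Lp Spinor 2 (volume : Measure ℝ)

/-- Real `4`-vectors `(s₀, s₁, s₂, s₃)`. -/
abbrev Coeff : Type := EuclideanSpace ℝ (Fin 4)

abbrev Mat2 : Type := Matrix (Fin 2) (Fin 2) ℂ

/-! ### Matrices -/

/-- The Pauli matrices `σ₀, σ₁, σ₂, σ₃`. -/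
def pauli : Fin 4 → Mat2 :=
  ![!![1, 0; 0, 1], !![0, 1; 1, 0], !![0, -Complex.I; Complex.I, 0], !![1, 0; 0, -1]]

/-- `c · σ = ∑ α, c α σ_α`. -/
def pauliDot (c : Coeff) : Mat2 := ∑ α, (c α : ℂ) • pauli α

/-- A matrix applied to a vector of `ℂ²`. -/
def act (A : Mat2) (v : Spinor) : Spinor := WithLp.toLp 2 (A.mulVec v.ofLp)

/-- The real number `⟨v, γ v⟩_{ℂ²} = ∑ j, v_j * conj ((γ v)_j)` (for Hermitian `γ`; Mathlib's inner
product is conjugate linear in its first argument). -/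
def quadForm (γ : Mat2) (v : Spinor) : ℝ := (inner ℂ (act γ v) v).re

/-! ### The nonlinear quantum walk

A function on `δℤ` is written as a function of `n : ℤ`, its value at the point `x = δ n`. -/

/-- The shift `S_δ`: `(S_δ u)(x) = (u₁(x - δ), u₂(x + δ))`. -/
def shift (u : ℤ → Spinor) : ℤ → Spinor := fun n => !₂[u (n - 1) 0, u (n + 1) 1]

/-- The linear coin `(C_δ u)(x) = exp(-i δ a(x)·σ) u(x)`. -/
def coin (a : ℝ → Coeff) (δ : ℝ) (u : ℤ → Spinor) : ℤ → Spinor := fun n =>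
  act (NormedSpace.exp (-(Complex.I * (δ : ℂ)) • pauliDot (a (δ * n)))) (u n)

/-- The nonlinear coin `(N_δ u)(x) = exp(-i δ g(⟨u(x), γ u(x)⟩) γ) u(x)`. -/
def nonlinearCoin (γ : Mat2) (g : ℝ → ℝ) (δ : ℝ) (u : ℤ → Spinor) : ℤ → Spinor := fun n =>
  act (NormedSpace.exp (-(Complex.I * (δ : ℂ) * (g (quadForm γ (u n)) : ℂ)) • γ)) (u n)

/-- The walk: `U_δ(0) u = u`, `U_δ(m+1) u = S_δ C_δ N_δ (U_δ(m) u)`. -/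
def walk (a : ℝ → Coeff) (γ : Mat2) (g : ℝ → ℝ) (δ : ℝ) : ℕ → (ℤ → Spinor) → (ℤ → Spinor)
  | 0, u => u
  | m + 1, u => shift (coin a δ (nonlinearCoin γ g δ (walk a γ g δ m u)))

/-! ### Band limitation and Shannon interpolation

Mathlib's Fourier transform is `𝓕 f (η) = ∫ exp(-2πi x η) f x dx`. In terms of the angular frequency
`ξ = 2πη` the band `|ξ| ≤ π/δ` is `|η| ≤ 1/(2δ)`. -/

/-- The band `|2πη| ≤ π/δ`. -/
def band (δ : ℝ) : Set ℝ := Set.Icc (-(1 / (2 * δ))) (1 / (2 * δ))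

/-- `j_δ = F⁻¹ χ_{[-π/δ, π/δ]} F`, the projection of `L²` onto the space `H_δ` of band-limited
functions. -/
def bandProj (δ : ℝ) (f : L2) : L2 :=
  𝓕⁻ (((Lp.memLp (𝓕 f : L2)).indicator (s := band δ) measurableSet_Icc).toLp _ : L2)

theorem memLp_latticeMode (δ : ℝ) (n : ℤ) (c : Spinor) :
    MemLp ((band δ).indicator fun η : ℝ =>
      ((δ : ℂ) * Complex.exp (-(2 * Real.pi * Complex.I * (δ * n * η)))) • c) 2 volume := by
  rw [memLp_indicator_iff_restrict (s := band δ) measurableSet_Icc]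
  have : IsFiniteMeasure (volume.restrict (band δ)) := by
    unfold band; infer_instance
  refine MemLp.of_bound (C := |δ| * ‖c‖) ?_ ?_
  · exact Continuous.aestronglyMeasurable (by fun_prop)
  · refine Eventually.of_forall fun η => ?_
    have h : -(2 * Real.pi * Complex.I * (δ * n * η) : ℂ)
        = ((-(2 * Real.pi * (δ * n * η)) : ℝ) : ℂ) * Complex.I := by
      push_cast; ring
    rw [norm_smul, norm_mul, h, Complex.norm_exp_ofReal_mul_I]
    simp

/-- The function `η ↦ δ exp(-i x ξ) c` (`x = δ n`, `ξ = 2πη`) on the band, extended by zero. -/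
def latticeMode (δ : ℝ) (n : ℤ) (c : Spinor) : L2 := (memLp_latticeMode δ n c).toLp _

/-- The discrete Fourier transform `ξ ↦ δ ∑ₓ exp(-i x ξ) u(x)` of `u ∈ ℓ²(δℤ, ℂ²)` on the band,
extended by zero. The sum is an (orthogonal) series in `L²`. -/
def discreteFourier (δ : ℝ) (u : ℤ → Spinor) : L2 := ∑' n : ℤ, latticeMode δ n (u n)

/-- The Shannon interpolation `I_δ : ℓ²(δℤ, ℂ²) → H_δ ⊆ L²`. -/
def shannon (δ : ℝ) (u : ℤ → Spinor) : L2 := 𝓕⁻ (discreteFourier δ u)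

/-- The inverse `I_δ⁻¹ : H_δ → ℓ²(δℤ, ℂ²)`: the Fourier transform followed by the inverse
discrete Fourier transform. -/
def shannonInv (δ : ℝ) (f : L2) : ℤ → Spinor := fun n =>
  ∫ η in band δ, Complex.exp (2 * Real.pi * Complex.I * (δ * n * η)) • (𝓕 f : L2) η

/-! ### Sobolev spaces `H^k(ℝ, ℂ²)` -/

/-- `v ∈ L²` is the `j`-th weak (distributional) derivative of `u ∈ L²`. -/
def IsWeakDeriv (j : ℕ) (u v : L2) : Prop :=
  (fun S : 𝓢'(ℝ, Spinor) => ∂_{(1 : ℝ)} S)^[j] (u : 𝓢'(ℝ, Spinor)) = (v : 𝓢'(ℝ, Spinor))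

open Classical in
/-- The `j`-th weak derivative of `u` if it exists in `L²`, and `0` otherwise. -/
def weakDeriv (j : ℕ) (u : L2) : L2 :=
  if h : ∃ v, IsWeakDeriv j u v then h.choose else 0

/-- `u ∈ H^k`. -/
def MemH (k : ℕ) (u : L2) : Prop := ∀ j ≤ k, ∃ v, IsWeakDeriv j u v

/-- `‖u‖_{H^k} = (∑_{j ≤ k} ‖∂ₓʲ u‖²)^{1/2}`. -/
def sobolevNorm (k : ℕ) (u : L2) : ℝ :=
  √(∑ j ∈ Finset.range (k + 1), ‖weakDeriv j u‖ ^ 2)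

/-! ### The nonlinear Dirac equation -/

/-- `u ∈ C([0, T], H^s)` with `u(0) = u₀` solves
`i ∂ₜ u = -i σ₃ ∂ₓ u + a·σ u + g(⟨u, γ u⟩) γ u` on `[0, T]`, the time derivative being the
derivative of an `L²`-valued function (one-sided at the end points). -/
structure IsDiracSolution (s : ℕ) (a : ℝ → Coeff) (γ : Mat2) (g : ℝ → ℝ) (T : ℝ) (u₀ : L2)
    (u : ℝ → L2) : Prop where
  initial : u 0 = u₀
  memH : ∀ t ∈ Set.Icc 0 T, MemH s (u t)
  continuous : ∀ t₀ ∈ Set.Icc 0 T,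
    Tendsto (fun t => sobolevNorm s (u t - u t₀)) (𝓝[Set.Icc 0 T] t₀) (𝓝 0)
  equation : ∀ t ∈ Set.Icc 0 T, ∃ w : L2, HasDerivWithinAt u w (Set.Icc 0 T) t ∧
    ∀ᵐ x : ℝ, Complex.I • w x =
      -Complex.I • act (pauli 3) (weakDeriv 1 (u t) x) + act (pauliDot (a x)) (u t x)
        + (g (quadForm γ (u t x)) : ℂ) • act γ (u t x)

/-- Condition `(Lip)_s` for the pair `(T, L)`: the initial data in the ball of radius `L` of `H^s`
have solutions in `C([0, T], H^s)`, and these depend on the data in a Lipschitz way. -/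
def LipCondition (s : ℕ) (a : ℝ → Coeff) (γ : Mat2) (g : ℝ → ℝ) (T L : ℝ) : Prop :=
  ∃ C : ℝ, 0 < C ∧ ∀ u₁ u₂ : L2, MemH s u₁ → MemH s u₂ →
    sobolevNorm s u₁ ≤ L → sobolevNorm s u₂ ≤ L →
      ∃ v₁ v₂ : ℝ → L2, IsDiracSolution s a γ g T u₁ v₁ ∧ IsDiracSolution s a γ g T u₂ v₂ ∧
        ∀ t ∈ Set.Icc 0 T, sobolevNorm s (v₁ t - v₂ t) ≤ C * sobolevNorm s (u₁ - u₂)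

end NLQW

end

open NLQW

/-!
Stability and consistency of the walk imply its convergence. On step functions with steps of length
`δ` the shift of the walk is the free Dirac evolution `transport δ`, a unitary group on `L²`, so one
step of the walk is a bounded perturbation of a map of `L²` into itself. If the nonlinearity is
modified outside a ball of `ℂ²` so as to become bounded and Lipschitz, this map is Lipschitz with
constant `1 + O(δ)`, and by Duhamel's formula a solution of the Dirac equation satisfies it up to an
error `o(δ)`, uniformly on `[0, T]`; the discrete Gronwall inequality gives convergence in `L²`.

The modification is harmless, since the walk stays close to the solution in the supremum norm: its
difference quotients remain bounded in `ℓ²`, so a value far from the solution at one lattice point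
would persist on an interval of fixed length and contradict convergence in `L²`. Finally, the
Shannon interpolation of a lattice function has the same `L²` norm as its step function, and
sampling and band limiting tend to the identity uniformly on the compact orbit of the solution.
-/

noncomputable section

namespace NLQW

/-! ### Unitary groups and the local step of the walk -/

section UnitaryGroup

variable {𝔄 : Type*} [CStarAlgebra 𝔄]

theorem norm_exp_sub_exp_le {X Y : 𝔄} (hX : X ∈ skewAdjoint 𝔄) (hY : Y ∈ skewAdjoint 𝔄) :
    ‖NormedSpace.exp X - NormedSpace.exp Y‖ ≤ ‖X - Y‖ := by
  let _ : NormedAlgebra ℚ 𝔄 := NormedAlgebra.restrictScalars ℚ ℂ 𝔄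
  let U (s : ℝ) : 𝔄 := NormedSpace.exp (s • X)
  let V (s : ℝ) : 𝔄 := NormedSpace.exp ((1 - s) • Y)
  have hU (s : ℝ) : U s ∈ unitary 𝔄 :=
    NormedSpace.exp_mem_unitary_of_mem_skewAdjoint (skewAdjoint.smul_mem s hX)
  have hV (s : ℝ) : V s ∈ unitary 𝔄 :=
    NormedSpace.exp_mem_unitary_of_mem_skewAdjoint (skewAdjoint.smul_mem (1 - s) hY)
  have hderiv (s : ℝ) : HasDerivAt (fun s => U s * V s) (U s * (X - Y) * V s) s := by
    have hU' : HasDerivAt U (U s * X) s := hasDerivAt_exp_smul_const X s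
    have hV' : HasDerivAt V ((-1 : ℝ) • (Y * V s)) s :=
      (hasDerivAt_exp_smul_const' Y (1 - s)).scomp s ((hasDerivAt_id s).const_sub 1)
    convert! hU'.mul hV' using 1
    rw [neg_one_smul]
    noncomm_ring
  have hnorm (s : ℝ) : ‖U s * (X - Y) * V s‖ = ‖X - Y‖ := by
    rw [CStarRing.norm_mul_mem_unitary _ (hV s), CStarRing.norm_mem_unitary_mul _ (hU s)]
  simpa [U, V] using norm_image_sub_le_of_norm_deriv_le_segment_01'
    (fun s _ => (hderiv s).hasDerivWithinAt) fun s _ => (hnorm s).le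

theorem norm_exp_sub_one_sub_le {X : 𝔄} (hX : X ∈ skewAdjoint 𝔄) :
    ‖NormedSpace.exp X - 1 - X‖ ≤ ‖X‖ ^ 2 := by
  have hderiv (s : ℝ) : HasDerivAt (fun s : ℝ => NormedSpace.exp (s • X) - s • X)
      ((NormedSpace.exp (s • X) - 1) * X) s := by
    convert! (hasDerivAt_exp_smul_const X s).sub ((hasDerivAt_id s).smul_const X) using 1
    rw [sub_mul, one_mul, one_smul]
  have hnorm (s : ℝ) (hs : s ∈ Set.Ico (0 : ℝ) 1) :
      ‖(NormedSpace.exp (s • X) - 1) * X‖ ≤ ‖X‖ ^ 2 := by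
    have h := norm_exp_sub_exp_le (skewAdjoint.smul_mem s hX) (zero_mem (skewAdjoint 𝔄))
    rw [NormedSpace.exp_zero, sub_zero, norm_smul, Real.norm_of_nonneg hs.1] at h
    calc ‖(NormedSpace.exp (s • X) - 1) * X‖ ≤ s * ‖X‖ * ‖X‖ := norm_mul_le_of_le h le_rfl
      _ ≤ 1 * ‖X‖ * ‖X‖ := by gcongr; exact hs.2.le
      _ = ‖X‖ ^ 2 := by ring
  simpa [sub_right_comm] using norm_image_sub_le_of_norm_deriv_le_segment_01'
    (fun s _ => (hderiv s).hasDerivWithinAt) hnorm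

/-- The unitary group `exp (-i t A)` generated by a self-adjoint `A`. -/
def unitaryGroup (A : 𝔄) (t : ℝ) : 𝔄 := NormedSpace.exp (-(Complex.I * (t : ℂ)) • A)

variable {A B : 𝔄}

theorem neg_I_mul_smul_mem_skewAdjoint (hA : IsSelfAdjoint A) (t : ℝ) :
    -(Complex.I * (t : ℂ)) • A ∈ skewAdjoint 𝔄 :=
  hA.smul_mem_skewAdjoint (by simp [skewAdjoint.mem_iff])

theorem unitaryGroup_mem_unitary (hA : IsSelfAdjoint A) (t : ℝ) : unitaryGroup A t ∈ unitary 𝔄 :=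
  let _ : NormedAlgebra ℚ 𝔄 := NormedAlgebra.restrictScalars ℚ ℂ 𝔄
  NormedSpace.exp_mem_unitary_of_mem_skewAdjoint (neg_I_mul_smul_mem_skewAdjoint hA t)

theorem norm_unitaryGroup_sub_le (hA : IsSelfAdjoint A) (hB : IsSelfAdjoint B) (t r : ℝ) :
    ‖unitaryGroup A t - unitaryGroup B r‖ ≤ ‖t • A - r • B‖ := by
  calc ‖unitaryGroup A t - unitaryGroup B r‖
      ≤ ‖-(Complex.I * (t : ℂ)) • A - -(Complex.I * (r : ℂ)) • B‖ :=
        norm_exp_sub_exp_le (neg_I_mul_smul_mem_skewAdjoint hA t)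
          (neg_I_mul_smul_mem_skewAdjoint hB r)
    _ = ‖(-Complex.I) • (t • A - r • B)‖ := by
        simp only [smul_sub, ← Complex.coe_smul, smul_smul, neg_mul]
    _ = ‖t • A - r • B‖ := by simp [norm_smul]

theorem norm_unitaryGroup_sub_one_le (hA : IsSelfAdjoint A) (t : ℝ) :
    ‖unitaryGroup A t - 1‖ ≤ |t| * ‖A‖ := by
  simpa [unitaryGroup, norm_smul] using norm_unitaryGroup_sub_le hA hA t 0

theorem norm_unitaryGroup_sub_euler_le (hA : IsSelfAdjoint A) (t : ℝ) :
    ‖unitaryGroup A t - (1 - (Complex.I * (t : ℂ)) • A)‖ ≤ (|t| * ‖A‖) ^ 2 := by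
  have h := norm_exp_sub_one_sub_le (neg_I_mul_smul_mem_skewAdjoint hA t)
  rw [neg_smul, norm_neg, norm_smul] at h
  simpa [unitaryGroup, ← sub_add] using h

end UnitaryGroup

section SplitStep

variable {E : Type*} [NormedAddCommGroup E] {G : E → ℝ} {K : ℝ}

/-- A bounded nonlinearity `G` for which `v ↦ G v • v` is Lipschitz, in the form in which these two
properties enter the estimates. -/
structure IsTame (G : E → ℝ) (K : ℝ) : Prop where
  bound : ∀ v, |G v| ≤ K
  lipschitz : ∀ v w, |G v - G w| * ‖w‖ ≤ K * ‖v - w‖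

theorem IsTame.nonneg (hG : IsTame G K) : 0 ≤ K := (abs_nonneg (G 0)).trans (hG.bound 0)

variable [InnerProductSpace ℂ E]

/-- The right-hand side `A v + G(v) Γ v` of the equation `i v' = A v + G(v) Γ v`. -/
def potential (A Γ : E →L[ℂ] E) (G : E → ℝ) (v : E) : E := A v + (G v : ℂ) • Γ v

theorem norm_potential_sub_le (A Γ : E →L[ℂ] E) (hG : IsTame G K) (v w : E) :
    ‖potential A Γ G v - potential A Γ G w‖ ≤ (‖A‖ + 2 * (K * ‖Γ‖)) * ‖v - w‖ := by
  have hsplit : potential A Γ G v - potential A Γ G w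
      = A (v - w) + (G v : ℂ) • Γ (v - w) + ((G v - G w : ℝ) : ℂ) • Γ w := by
    simp only [potential, map_sub, smul_sub, Complex.ofReal_sub, sub_smul]
    abel
  calc ‖potential A Γ G v - potential A Γ G w‖
      ≤ ‖A (v - w)‖ + |G v| * ‖Γ (v - w)‖ + |G v - G w| * ‖Γ w‖ := by
        rw [hsplit]
        refine norm_add₃_le.trans_eq ?_
        rw [norm_smul, norm_smul, Complex.norm_real, Complex.norm_real, Real.norm_eq_abs,
          Real.norm_eq_abs]
    _ ≤ ‖A‖ * ‖v - w‖ + K * (‖Γ‖ * ‖v - w‖) + |G v - G w| * (‖Γ‖ * ‖w‖) := by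
        gcongr
        · exact A.le_opNorm _
        · exact hG.nonneg
        · exact hG.bound v
        · exact Γ.le_opNorm _
        · exact Γ.le_opNorm _
    _ = (‖A‖ + K * ‖Γ‖) * ‖v - w‖ + ‖Γ‖ * (|G v - G w| * ‖w‖) := by ring
    _ ≤ (‖A‖ + K * ‖Γ‖) * ‖v - w‖ + ‖Γ‖ * (K * ‖v - w‖) := by
        gcongr _ + _ * ?_
        exact hG.lipschitz v w
    _ = (‖A‖ + 2 * (K * ‖Γ‖)) * ‖v - w‖ := by ring

theorem potential_zero (A Γ : E →L[ℂ] E) (G : E → ℝ) : potential A Γ G 0 = 0 := by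
  simp [potential]

theorem potential_sub_potential (A A' Γ : E →L[ℂ] E) (G : E → ℝ) (v : E) :
    potential A Γ G v - potential A' Γ G v = (A - A') v := by
  simp [potential]

variable [CompleteSpace E] {A A' Γ : E →L[ℂ] E}

/-- One step of a splitting scheme for `i v' = A v + G(v) Γ v`: the nonlinear phase, with `G` frozen
at the initial value, followed by the linear evolution. -/
def splitStep (A Γ : E →L[ℂ] E) (G : E → ℝ) (δ : ℝ) (v : E) : E :=
  unitaryGroup A δ (unitaryGroup Γ (δ * G v) v)

theorem norm_unitaryGroup_apply (hA : IsSelfAdjoint A) (t : ℝ) (v : E) :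
    ‖unitaryGroup A t v‖ = ‖v‖ :=
  ContinuousLinearMap.norm_map_of_mem_unitary (unitaryGroup_mem_unitary hA t) v

theorem norm_splitStep (hA : IsSelfAdjoint A) (hΓ : IsSelfAdjoint Γ) (G : E → ℝ) (δ : ℝ) (v : E) :
    ‖splitStep A Γ G δ v‖ = ‖v‖ := by
  rw [splitStep, norm_unitaryGroup_apply hA, norm_unitaryGroup_apply hΓ]

theorem norm_splitStep_sub_le (hA : IsSelfAdjoint A) (hΓ : IsSelfAdjoint Γ) (hG : IsTame G K)
    {δ : ℝ} (hδ : 0 ≤ δ) (v w : E) :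
    ‖splitStep A Γ G δ v - splitStep A Γ G δ w‖ ≤ (1 + δ * (K * ‖Γ‖)) * ‖v - w‖ := by
  let U := unitaryGroup Γ (δ * G v)
  let V := unitaryGroup Γ (δ * G w)
  have hUV : ‖U - V‖ ≤ δ * |G v - G w| * ‖Γ‖ := by
    refine (norm_unitaryGroup_sub_le hΓ hΓ _ _).trans_eq ?_
    rw [← sub_smul, ← mul_sub, norm_smul, Real.norm_eq_abs, abs_mul, abs_of_nonneg hδ]
  have hsplit : U v - V w = U (v - w) + (U - V) w := by simp
  calc ‖splitStep A Γ G δ v - splitStep A Γ G δ w‖ = ‖U v - V w‖ := by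
        rw [splitStep, splitStep, ← map_sub, norm_unitaryGroup_apply hA]
    _ ≤ ‖U (v - w)‖ + ‖(U - V) w‖ := hsplit ▸ norm_add_le _ _
    _ ≤ ‖v - w‖ + δ * |G v - G w| * ‖Γ‖ * ‖w‖ :=
        add_le_add (norm_unitaryGroup_apply hΓ _ _).le ((U - V).le_of_opNorm_le hUV w)
    _ = ‖v - w‖ + δ * ‖Γ‖ * (|G v - G w| * ‖w‖) := by ring
    _ ≤ ‖v - w‖ + δ * ‖Γ‖ * (K * ‖v - w‖) := by gcongr _ + _ * ?_; exact hG.lipschitz v w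
    _ = (1 + δ * (K * ‖Γ‖)) * ‖v - w‖ := by ring

theorem norm_splitStep_sub_splitStep_le (hA : IsSelfAdjoint A) (hA' : IsSelfAdjoint A')
    (hΓ : IsSelfAdjoint Γ) (G : E → ℝ) {δ : ℝ} (hδ : 0 ≤ δ) (v : E) :
    ‖splitStep A Γ G δ v - splitStep A' Γ G δ v‖ ≤ δ * ‖A - A'‖ * ‖v‖ := by
  have h : ‖unitaryGroup A δ - unitaryGroup A' δ‖ ≤ δ * ‖A - A'‖ := by
    refine (norm_unitaryGroup_sub_le hA hA' δ δ).trans_eq ?_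
    rw [← smul_sub, norm_smul, Real.norm_of_nonneg hδ]
  rw [splitStep, splitStep, ← sub_apply, ← norm_unitaryGroup_apply hΓ (δ * G v) v]
  exact ContinuousLinearMap.le_of_opNorm_le _ h _

theorem norm_splitStep_sub_euler_le (hA : IsSelfAdjoint A) (hΓ : IsSelfAdjoint Γ)
    (hG : IsTame G K) {δ : ℝ} (hδ : 0 ≤ δ) (v : E) :
    ‖splitStep A Γ G δ v - (v - (δ * Complex.I : ℂ) • potential A Γ G v)‖
      ≤ (δ * (‖A‖ + K * ‖Γ‖)) ^ 2 * ‖v‖ := by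
  let U := unitaryGroup A δ
  let V := unitaryGroup Γ (δ * G v)
  have hr : |δ * G v| * ‖Γ‖ ≤ δ * (K * ‖Γ‖) := by
    rw [abs_mul, abs_of_nonneg hδ, mul_assoc]
    gcongr
    exact hG.bound v
  have hU : ‖U - (1 - (Complex.I * δ) • A)‖ ≤ (δ * ‖A‖) ^ 2 := by
    simpa [abs_of_nonneg hδ] using norm_unitaryGroup_sub_euler_le hA δ
  have hVone : ‖V - 1‖ ≤ δ * (K * ‖Γ‖) := (norm_unitaryGroup_sub_one_le hΓ _).trans hr
  have hV : ‖V - (1 - (Complex.I * (δ * G v : ℝ)) • Γ)‖ ≤ (δ * (K * ‖Γ‖)) ^ 2 :=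
    (norm_unitaryGroup_sub_euler_le hΓ _).trans (by gcongr)
  have hIA : ‖(Complex.I * δ) • A‖ ≤ δ * ‖A‖ := by simp [norm_smul, abs_of_nonneg hδ]
  have hsplit : splitStep A Γ G δ v - (v - (δ * Complex.I : ℂ) • potential A Γ G v)
      = (U - (1 - (Complex.I * δ) • A)) (V v) + (-((Complex.I * δ) • A)) ((V - 1) v)
        + (V - (1 - (Complex.I * (δ * G v : ℝ)) • Γ)) v := by
    simp only [splitStep, potential, U, V, sub_apply, neg_apply, smul_apply,
      one_apply_eq_self, map_sub, smul_add, smul_smul]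
    push_cast
    rw [mul_comm (δ : ℂ) Complex.I, mul_assoc]
    abel
  have hfirst := ContinuousLinearMap.le_of_opNorm_le _ hU (V v)
  have hlast := ContinuousLinearMap.le_of_opNorm_le _ hV v
  have hcross := ContinuousLinearMap.le_of_opNorm_le_of_le _ ((norm_neg _).trans_le hIA)
    (ContinuousLinearMap.le_of_opNorm_le _ hVone v)
  rw [norm_unitaryGroup_apply hΓ] at hfirst
  rw [hsplit]
  refine norm_add₃_le.trans ((add_le_add_three hfirst hcross hlast).trans ?_)
  have := hG.nonneg
  have : 0 ≤ δ * ‖A‖ * (δ * (K * ‖Γ‖)) * ‖v‖ := by positivity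
  linarith

end SplitStep

/-! ### Translations and modulations of `Lᵖ` functions -/

section LpNorm

variable {α E F G : Type*} [MeasurableSpace α] {μ : Measure α} {p : ENNReal}
  [NormedAddCommGroup E] [NormedAddCommGroup F] [NormedAddCommGroup G]

theorem norm_sq_eq_integral (f : Lp E 2 μ) : ‖f‖ ^ 2 = ∫ x, ‖f x‖ ^ 2 ∂μ := by
  have hnorm : ‖f‖ = √(∫ x, ‖f x‖ ^ 2 ∂μ) := by
    rw [Lp.norm_def, (Lp.memLp f).eLpNorm_eq_integral_rpow_norm two_ne_zero ENNReal.ofNat_ne_top,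
      ENNReal.toReal_ofReal (by positivity), Real.sqrt_eq_rpow]
    norm_num
  rw [hnorm, Real.sq_sqrt (integral_nonneg fun x => by positivity)]

theorem integrable_norm_sq (f : Lp E 2 μ) : Integrable (fun x => ‖f x‖ ^ 2) μ :=
  (memLp_two_iff_integrable_sq_norm (Lp.aestronglyMeasurable f)).1 (Lp.memLp f)

theorem norm_le_add_mul_of_ae_le [Fact (1 ≤ p)] {f : Lp E p μ} {g : Lp F p μ} {h : Lp G p μ}
    {c d : ℝ} (hc : 0 ≤ c) (hd : 0 ≤ d) (hle : ∀ᵐ x ∂μ, ‖f x‖ ≤ c * ‖g x‖ + d * ‖h x‖) :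
    ‖f‖ ≤ c * ‖g‖ + d * ‖h‖ := by
  have hg := (Lp.memLp g).norm.const_mul c
  have hh := (Lp.memLp h).norm.const_mul d
  have hg_norm : ‖hg.toLp‖ ≤ c * ‖g‖ := by
    refine Lp.norm_le_mul_norm_of_ae_le_mul ?_
    filter_upwards [hg.coeFn_toLp] with x hx
    rw [hx, Real.norm_of_nonneg (by positivity)]
  have hh_norm : ‖hh.toLp‖ ≤ d * ‖h‖ := by
    refine Lp.norm_le_mul_norm_of_ae_le_mul ?_
    filter_upwards [hh.coeFn_toLp] with x hx
    rw [hx, Real.norm_of_nonneg (by positivity)]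
  calc ‖f‖ ≤ ‖(hg.add hh).toLp‖ := by
        refine Lp.norm_le_norm_of_ae_le ?_
        filter_upwards [hle, (hg.add hh).coeFn_toLp] with x hx hsum
        rw [hsum]
        exact hx.trans (le_abs_self _)
    _ ≤ ‖hg.toLp‖ + ‖hh.toLp‖ := by rw [MemLp.toLp_add]; exact norm_add_le _ _
    _ ≤ c * ‖g‖ + d * ‖h‖ := add_le_add hg_norm hh_norm

end LpNorm

theorem ae_comp_sub {P : ℝ → Prop} (h : ∀ᵐ x, P x) (r : ℝ) : ∀ᵐ x : ℝ, P (x - r) :=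
  (measurePreserving_sub_right volume r).quasiMeasurePreserving.ae h

theorem ae_comp_add {P : ℝ → Prop} (h : ∀ᵐ x, P x) (r : ℝ) : ∀ᵐ x : ℝ, P (x + r) :=
  (measurePreserving_add_right volume r).quasiMeasurePreserving.ae h

section Translate

variable {E : Type*} [NormedAddCommGroup E] [NormedSpace ℂ E] {p : ENNReal}

/-- The character `η ↦ exp (-2πi r η)`, the Fourier multiplier of the translation by `r`. -/
def phase (r η : ℝ) : ℂ := Complex.exp (Complex.I * ((-(2 * Real.pi * r * η) : ℝ) : ℂ))

theorem norm_phase (r η : ℝ) : ‖phase r η‖ = 1 := by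
  rw [phase, mul_comm, Complex.norm_exp_ofReal_mul_I]

@[fun_prop]
theorem continuous_phase (r : ℝ) : Continuous (phase r) := by
  unfold phase; fun_prop

theorem norm_phase_sub_one_le (r η : ℝ) : ‖phase r η - 1‖ ≤ 2 * Real.pi * |r| * |η| := by
  refine Real.norm_exp_I_mul_ofReal_sub_one_le.trans_eq ?_
  rw [norm_neg, norm_mul, norm_mul, Real.norm_of_nonneg (by positivity), Real.norm_eq_abs,
    Real.norm_eq_abs]

theorem hasDerivAt_phase_zero (η : ℝ) :
    HasDerivAt (fun r => phase r η) (-(2 * Real.pi * Complex.I * η)) 0 := by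
  have harg : HasDerivAt (fun r : ℝ => ((-(2 * Real.pi * r * η) : ℝ) : ℂ))
      ((-(2 * Real.pi * 1 * η) : ℝ) : ℂ) 0 :=
    ((((hasDerivAt_id (0 : ℝ)).const_mul (2 * Real.pi)).mul_const η).neg).ofReal_comp
  refine (harg.const_mul Complex.I).cexp.congr_deriv ?_
  simp
  ring

theorem memLp_phase_smul (r : ℝ) (f : Lp E p (volume : Measure ℝ)) :
    MemLp (fun η => phase r η • f η) p volume := by
  refine (Lp.memLp f).of_le
    ((continuous_phase r).aestronglyMeasurable.smul (Lp.aestronglyMeasurable f)) ?_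
  filter_upwards with η
  rw [norm_smul, norm_phase, one_mul]

variable [Fact (1 ≤ p)]

/-- Translation by `r` on `Lᵖ(ℝ, E)`: `(translate r f)(x) = f (x - r)`. -/
def translate (r : ℝ) : Lp E p (volume : Measure ℝ) →ₗᵢ[ℂ] Lp E p (volume : Measure ℝ) :=
  Lp.compMeasurePreservingₗᵢ ℂ (fun x => x - r) (measurePreserving_sub_right volume r)

theorem coeFn_translate (r : ℝ) (f : Lp E p (volume : Measure ℝ)) :
    translate r f =ᵐ[volume] fun x => f (x - r) :=
  Lp.coeFn_compMeasurePreserving f (measurePreserving_sub_right volume r)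

theorem translate_translate (r s : ℝ) (f : Lp E p (volume : Measure ℝ)) :
    translate r (translate s f) = translate (r + s) f := by
  ext1
  filter_upwards [coeFn_translate r (translate s f), ae_comp_sub (coeFn_translate s f) r,
    coeFn_translate (r + s) f] with x h1 h2 h3
  rw [h1, h2, h3, sub_sub]

theorem translate_zero (f : Lp E p (volume : Measure ℝ)) : translate 0 f = f := by
  ext1
  filter_upwards [coeFn_translate 0 f] with x hx
  rw [hx, sub_zero]

theorem continuous_translate (hp : p ≠ ⊤) :
    Continuous fun q : ℝ × Lp E p (volume : Measure ℝ) => translate q.1 q.2 := by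
  let g : ℝ × Lp E p (volume : Measure ℝ) → C(ℝ, ℝ) := fun q => ⟨fun x => x - q.1, by fun_prop⟩
  have hg : Continuous g := by
    refine ContinuousMap.continuous_of_continuous_uncurry _ ?_
    change Continuous fun q : (ℝ × Lp E p (volume : Measure ℝ)) × ℝ => q.2 - q.1.1
    fun_prop
  exact continuous_snd.compMeasurePreservingLp hg
    (fun q => measurePreserving_sub_right volume q.1) hp

/-- Multiplication by the character `phase r` on `Lᵖ(ℝ, E)`. -/
def modulate (r : ℝ) : Lp E p (volume : Measure ℝ) →ₗᵢ[ℂ] Lp E p (volume : Measure ℝ) where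
  toFun f := (memLp_phase_smul r f).toLp
  map_add' f g := by
    ext1
    filter_upwards [(memLp_phase_smul r (f + g)).coeFn_toLp, (memLp_phase_smul r f).coeFn_toLp,
      (memLp_phase_smul r g).coeFn_toLp, Lp.coeFn_add f g,
      Lp.coeFn_add (memLp_phase_smul r f).toLp (memLp_phase_smul r g).toLp] with η h1 h2 h3 h4 h5
    rw [h1, h5, Pi.add_apply, h2, h3, h4, Pi.add_apply, smul_add]
  map_smul' c f := by
    ext1
    filter_upwards [(memLp_phase_smul r (c • f)).coeFn_toLp, (memLp_phase_smul r f).coeFn_toLp,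
      Lp.coeFn_smul c f, Lp.coeFn_smul c (memLp_phase_smul r f).toLp] with η h1 h2 h3 h4
    rw [h1, RingHom.id_apply, h4, Pi.smul_apply, h2, h3, Pi.smul_apply, smul_comm]
  norm_map' f := by
    refine (Lp.norm_toLp _ (memLp_phase_smul r f)).trans ?_
    rw [Lp.norm_def]
    refine congr_arg ENNReal.toReal (eLpNorm_congr_norm_ae (Eventually.of_forall fun η => ?_))
    rw [norm_smul, norm_phase, one_mul]

theorem coeFn_modulate (r : ℝ) (f : Lp E p (volume : Measure ℝ)) :
    modulate r f =ᵐ[volume] fun η => phase r η • f η :=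
  (memLp_phase_smul r f).coeFn_toLp

end Translate

section Fourier

variable {E : Type*} [NormedAddCommGroup E]

theorem fourier_compSubConst [NormedSpace ℂ E] (r : ℝ) (φ : 𝓢(ℝ, E)) (η : ℝ) :
    𝓕 (φ.compSubConstCLM ℂ r) η = phase r η • 𝓕 φ η := by
  rw [SchwartzMap.fourier_coe, SchwartzMap.fourier_coe, Real.fourier_real_eq_integral_exp_smul,
    Real.fourier_real_eq_integral_exp_smul, ← integral_smul,
    ← integral_sub_right_eq_self (fun x => phase r η • _ • φ x) r]
  congr 1 with x
  rw [SchwartzMap.compSubConstCLM_apply, smul_smul, phase, ← Complex.exp_add]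
  congr 2
  push_cast
  ring

theorem translate_toLp [NormedSpace ℂ E] (r : ℝ) (φ : 𝓢(ℝ, E)) :
    translate r (φ.toLp 2) = (φ.compSubConstCLM ℂ r).toLp 2 := by
  ext1
  filter_upwards [coeFn_translate r (φ.toLp 2), ae_comp_sub (φ.coeFn_toLp 2 volume) r,
    (φ.compSubConstCLM ℂ r).coeFn_toLp 2 volume] with x h1 h2 h3
  rw [h1, h2, h3, SchwartzMap.compSubConstCLM_apply]

variable [InnerProductSpace ℂ E] [CompleteSpace E]

theorem fourier_translate (r : ℝ) (f : Lp E 2 (volume : Measure ℝ)) :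
    𝓕 (translate r f) = modulate r (𝓕 f) := by
  have hdense : DenseRange (SchwartzMap.toLpCLM ℂ E 2 (volume : Measure ℝ)) :=
    SchwartzMap.denseRange_toLpCLM ENNReal.ofNat_ne_top
  have hfourier := (Lp.fourierTransformₗᵢ ℝ E).continuous
  induction f using hdense.induction_on with
  | hp =>
    exact isClosed_eq (hfourier.comp (translate r).continuous)
      ((modulate r).continuous.comp hfourier)
  | ih φ =>
    rw [SchwartzMap.toLpCLM_apply, translate_toLp, SchwartzMap.toLp_fourier_eq]
    ext1
    filter_upwards [(𝓕 (φ.compSubConstCLM ℂ r)).coeFn_toLp 2 volume,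
      coeFn_modulate r (𝓕 (φ.toLp 2 volume) : Lp E 2 (volume : Measure ℝ)),
      (𝓕 φ).coeFn_toLp 2 volume] with η h1 h2 h3
    rw [h1, h2, fourier_compSubConst, SchwartzMap.toLp_fourier_eq, h3]

end Fourier

/-! ### Weak derivatives and generators -/

theorem toTemperedDistribution_injective {f g : L2} (h : (f : 𝓢'(ℝ, Spinor)) = g) : f = g :=
  LinearMap.ker_eq_bot.1 (Lp.ker_toTemperedDistributionCLM_eq_bot (F := Spinor)
    (μ := (volume : Measure ℝ)) (p := 2)) h

theorem toTemperedDistribution_sub (f g : L2) :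
    ((f - g : L2) : 𝓢'(ℝ, Spinor)) = (f : 𝓢'(ℝ, Spinor)) - g :=
  map_sub (Lp.toTemperedDistributionCLM Spinor (volume : Measure ℝ) 2) f g

theorem IsWeakDeriv.unique {j : ℕ} {f g h : L2} (hg : IsWeakDeriv j f g) (hh : IsWeakDeriv j f h) :
    g = h :=
  toTemperedDistribution_injective (hg.symm.trans hh)

theorem IsWeakDeriv.weakDeriv_eq {j : ℕ} {f g : L2} (hg : IsWeakDeriv j f g) :
    weakDeriv j f = g := by
  have h : ∃ v, IsWeakDeriv j f v := ⟨g, hg⟩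
  rw [weakDeriv, dif_pos h]
  exact h.choose_spec.unique hg

theorem MemH.isWeakDeriv {k j : ℕ} {f : L2} (h : MemH k f) (hj : j ≤ k) :
    IsWeakDeriv j f (weakDeriv j f) := by
  obtain ⟨g, hg⟩ := h j hj
  rwa [hg.weakDeriv_eq]

theorem isWeakDeriv_one_iff {f g : L2} :
    IsWeakDeriv 1 f g ↔ ∂_{(1 : ℝ)} (f : 𝓢'(ℝ, Spinor)) = g := Iff.rfl

theorem IsWeakDeriv.sub {f g f' g' : L2} (hf : IsWeakDeriv 1 f f') (hg : IsWeakDeriv 1 g g') :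
    IsWeakDeriv 1 (f - g) (f' - g') := by
  rw [isWeakDeriv_one_iff] at *
  rw [toTemperedDistribution_sub, toTemperedDistribution_sub, ← hf, ← hg]
  exact map_sub (LineDeriv.lineDerivOpCLM ℂ 𝓢'(ℝ, Spinor) (1 : ℝ)) _ _

theorem IsWeakDeriv.fourier_apply_eq {f g : L2} (h : IsWeakDeriv 1 f g) {φ : ℝ → ℝ}
    (hφ : ContDiff ℝ ∞ φ) (hφc : HasCompactSupport φ) :
    ∫ η, φ η • (𝓕 g : L2) η
      = ∫ η, φ η • (2 * Real.pi * Complex.I * η : ℂ) • (𝓕 f : L2) η := by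
  have hψc : HasCompactSupport (Complex.ofRealCLM ∘ φ) := hφc.comp_left rfl
  have hψ : ContDiff ℝ ∞ (Complex.ofRealCLM ∘ φ) := by fun_prop
  have hgrowth : (fun x : ℝ => ((inner ℝ x (1 : ℝ) : ℝ) : ℂ)).HasTemperateGrowth := by fun_prop
  have happly : ∀ x, (hψc.toSchwartzMap hψ) x = (φ x : ℂ) := fun _ => rfl
  have hdistr := congr_arg (fun S : 𝓢'(ℝ, Spinor) => 𝓕 S (hψc.toSchwartzMap hψ))
    (isWeakDeriv_one_iff.1 h)
  simp only [TemperedDistribution.fourier_lineDerivOp_eq, Lp.fourier_toTemperedDistribution_eq,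
    TemperedDistribution.smulLeftCLM_apply_apply, smul_apply, Lp.toTemperedDistribution_apply,
    SchwartzMap.smulLeftCLM_apply_apply hgrowth, ← integral_smul, happly] at hdistr
  refine Eq.trans ?_ (hdistr.symm.trans ?_)
  · simp only [Complex.coe_smul]
  · refine integral_congr_ae (Eventually.of_forall fun η => ?_)
    simp only [smul_smul, ← Complex.coe_smul]
    congr 1
    simp
    ring

theorem IsWeakDeriv.fourier_eq {f g : L2} (h : IsWeakDeriv 1 f g) :
    (𝓕 g : L2) =ᵐ[volume] fun η : ℝ => (2 * Real.pi * Complex.I * η : ℂ) • (𝓕 f : L2) η := by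
  have hloc (F : L2) : LocallyIntegrable F := (Lp.memLp F).locallyIntegrable (by simp)
  exact ae_eq_of_integral_contDiff_smul_eq (hloc _)
    ((hloc (𝓕 f : L2)).continuous_smul (by fun_prop)) fun φ hφ hφc => h.fourier_apply_eq hφ hφc

theorem IsWeakDeriv.fourier_slope_translate_add {f g : L2} (h : IsWeakDeriv 1 f g) (t : ℝ) :
    (𝓕 (t⁻¹ • (translate t f - f) + g) : L2) =ᵐ[volume] fun η : ℝ =>
      (t⁻¹ • (phase t η - 1) + 2 * Real.pi * Complex.I * η) • (𝓕 f : L2) η := by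
  have hfourier : (𝓕 (t⁻¹ • (translate t f - f) + g) : L2)
      = t⁻¹ • (modulate t (𝓕 f) - 𝓕 f) + 𝓕 g := by
    rw [← fourier_translate]
    let 𝓕ₗ := Lp.fourierTransformₗᵢ ℝ Spinor
    exact (map_add 𝓕ₗ _ g).trans
      (congr_arg (· + 𝓕ₗ g) ((map_real_smul 𝓕ₗ 𝓕ₗ.continuous t⁻¹ _).trans
        (congr_arg (t⁻¹ • ·) (map_sub 𝓕ₗ _ f))))
  rw [hfourier]
  filter_upwards [Lp.coeFn_add (t⁻¹ • (modulate t (𝓕 f : L2) - 𝓕 f)) (𝓕 g),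
    Lp.coeFn_smul t⁻¹ (modulate t (𝓕 f : L2) - 𝓕 f),
    Lp.coeFn_sub (modulate t (𝓕 f : L2)) (𝓕 f), coeFn_modulate t (𝓕 f : L2), h.fourier_eq]
    with η hadd hsmul hsub hmod hderiv
  rw [hadd, Pi.add_apply, hsmul, Pi.smul_apply, hsub, Pi.sub_apply, hmod, hderiv, add_smul,
    smul_assoc, sub_smul, one_smul]

theorem norm_slope_phase_add_le {t : ℝ} (ht : t ≠ 0) (η : ℝ) :
    ‖t⁻¹ • (phase t η - 1) + 2 * Real.pi * Complex.I * η‖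
      ≤ 2 * ‖(2 * Real.pi * Complex.I * η : ℂ)‖ := by
  have hnorm : ‖(2 * Real.pi * Complex.I * η : ℂ)‖ = 2 * Real.pi * |η| := by
    simp [abs_of_pos Real.pi_pos]
  have hslope : ‖t⁻¹ • (phase t η - 1)‖ ≤ 2 * Real.pi * |η| := by
    rw [norm_smul, norm_inv, Real.norm_eq_abs, inv_mul_le_iff₀ (abs_pos.2 ht)]
    exact (norm_phase_sub_one_le t η).trans_eq (by ring)
  linarith [norm_add_le (t⁻¹ • (phase t η - 1)) (2 * Real.pi * Complex.I * η)]

theorem tendsto_slope_phase_add (η : ℝ) :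
    Tendsto (fun t : ℝ => t⁻¹ • (phase t η - 1) + 2 * Real.pi * Complex.I * η) (𝓝[≠] 0) (𝓝 0) := by
  have h := (hasDerivAt_iff_tendsto_slope_zero.1 (hasDerivAt_phase_zero η)).add_const
    (2 * Real.pi * Complex.I * η : ℂ)
  have hzero : phase 0 η = 1 := by simp [phase]
  simpa only [zero_add, hzero, neg_add_cancel] using h

theorem IsWeakDeriv.hasDerivAt_translate_zero {f g : L2} (h : IsWeakDeriv 1 f g) :
    HasDerivAt (fun r => translate r f) (-g) 0 := by
  let m (t η : ℝ) : ℂ := t⁻¹ • (phase t η - 1) + 2 * Real.pi * Complex.I * η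
  have hnorm (t : ℝ) :
      ‖t⁻¹ • (translate t f - f) + g‖ ^ 2 = ∫ η, ‖m t η • (𝓕 f : L2) η‖ ^ 2 := by
    rw [← Lp.norm_fourier_eq, norm_sq_eq_integral]
    refine integral_congr_ae ?_
    filter_upwards [h.fourier_slope_translate_add t] with η hη
    rw [hη]
  have hlim : Tendsto (fun t => ∫ η, ‖m t η • (𝓕 f : L2) η‖ ^ 2) (𝓝[≠] 0) (𝓝 (∫ _ : ℝ, 0)) := by
    refine tendsto_integral_filter_of_dominated_convergence (fun η => (2 * ‖(𝓕 g : L2) η‖) ^ 2)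
      ?_ ?_ ?_ ?_
    · filter_upwards with t
      have hm : Continuous (m t) := by fun_prop
      exact ((hm.aestronglyMeasurable.smul (Lp.aestronglyMeasurable _)).norm).pow 2
    · filter_upwards [self_mem_nhdsWithin] with t ht
      filter_upwards [h.fourier_eq] with η hη
      rw [Real.norm_of_nonneg (by positivity), hη, norm_smul, norm_smul, ← mul_assoc]
      gcongr
      exact norm_slope_phase_add_le ht η
    · simpa only [mul_pow] using (integrable_norm_sq (𝓕 g : L2)).const_mul (2 ^ 2)
    · filter_upwards with η
      have h := ((tendsto_slope_phase_add η).smul_const ((𝓕 f : L2) η)).norm.pow 2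
      rwa [zero_smul, norm_zero, zero_pow two_ne_zero] at h
  rw [hasDerivAt_iff_tendsto_slope_zero, tendsto_iff_norm_sub_tendsto_zero]
  simp only [zero_add, translate_zero, sub_neg_eq_add]
  simp only [← hnorm, integral_zero] at hlim
  simpa [Real.sqrt_sq] using hlim.sqrt

theorem IsWeakDeriv.hasDerivAt_translate {f g : L2} (h : IsWeakDeriv 1 f g) (r : ℝ) :
    HasDerivAt (fun r => translate r f) (-translate r g) r := by
  have hzero : HasDerivAt (fun s => translate s f) (-g) (r - r) := by
    rw [sub_self]
    exact h.hasDerivAt_translate_zero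
  have hcomp := ((translate r).toContinuousLinearMap.restrictScalars ℝ).hasFDerivAt.comp_hasDerivAt
    r (hzero.comp_sub_const r r)
  rw [← map_neg]
  refine hcomp.congr_of_eventuallyEq (Eventually.of_forall fun s => ?_)
  simp [translate_translate]

theorem IsWeakDeriv.norm_translate_sub_le {f g : L2} (h : IsWeakDeriv 1 f g) (r : ℝ) :
    ‖translate r f - f‖ ≤ ‖g‖ * |r| := by
  have hbound : ‖translate r f - translate 0 f‖ ≤ ‖g‖ * ‖r - 0‖ :=
    convex_univ.norm_image_sub_le_of_norm_hasDerivWithin_le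
      (fun x _ => (h.hasDerivAt_translate x).hasDerivWithinAt)
      (fun x _ => by rw [norm_neg, LinearIsometry.norm_map]) trivial trivial
  simpa [translate_zero] using hbound

/-! ### The free evolution -/

/-- The projection of `ℂ²` onto its `i`-th coordinate axis. -/
def component (i : Fin 2) : Spinor →L[ℂ] Spinor :=
  (EuclideanSpace.proj i : Spinor →L[ℂ] ℂ).smulRight (EuclideanSpace.single i 1)

theorem component_apply (i : Fin 2) (v : Spinor) (j : Fin 2) :
    component i v j = if j = i then v i else 0 := by
  simp [component]

/-- The projection of `L²` onto the spinor fields with values in the `i`-th coordinate axis. -/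
def part (i : Fin 2) : L2 →L[ℂ] L2 := (component i).compLpL 2 volume

theorem coeFn_part (i : Fin 2) (f : L2) : part i f =ᵐ[volume] fun x => component i (f x) :=
  (component i).coeFn_compLpL f

theorem part_part_self (i : Fin 2) (f : L2) : part i (part i f) = part i f := by
  ext1
  filter_upwards [coeFn_part i (part i f), coeFn_part i f] with x h1 h2
  rw [h1, h2]
  ext j
  simp [component_apply]

theorem part_part_of_ne {i j : Fin 2} (hij : i ≠ j) (f : L2) : part i (part j f) = 0 := by
  ext1
  filter_upwards [coeFn_part i (part j f), coeFn_part j f,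
    Lp.coeFn_zero Spinor 2 (volume : Measure ℝ)] with x h1 h2 h3
  rw [h1, h2, h3]
  ext k
  simp [component_apply, hij]

theorem part_translate (i : Fin 2) (r : ℝ) (f : L2) :
    part i (translate r f) = translate r (part i f) := by
  ext1
  filter_upwards [coeFn_part i (translate r f), coeFn_translate r f, coeFn_translate r (part i f),
    ae_comp_sub (coeFn_part i f) r] with x h1 h2 h3 h4
  rw [h1, h2, h3, h4]

/-- The free Dirac evolution `(transport r f)(x) = (f₁(x - r), f₂(x + r))`. -/
def transport (r : ℝ) : L2 →L[ℂ] L2 :=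
  (translate r).toContinuousLinearMap ∘L part 0 + (translate (-r)).toContinuousLinearMap ∘L part 1

theorem transport_apply (r : ℝ) (f : L2) :
    transport r f = translate r (part 0 f) + translate (-r) (part 1 f) := rfl

theorem coeFn_transport (r : ℝ) (f : L2) :
    transport r f =ᵐ[volume] fun x => !₂[f (x - r) 0, f (x + r) 1] := by
  rw [transport_apply]
  filter_upwards [Lp.coeFn_add (translate r (part 0 f)) (translate (-r) (part 1 f)),
    coeFn_translate r (part 0 f), coeFn_translate (-r) (part 1 f),
    ae_comp_sub (coeFn_part 0 f) r, ae_comp_add (coeFn_part 1 f) r] with x h1 h2 h3 h4 h5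
  rw [h1, Pi.add_apply, h2, h3, h4, sub_neg_eq_add, h5]
  ext j
  fin_cases j <;> simp [component_apply]

theorem transport_translate (r s : ℝ) (f : L2) :
    transport r (translate s f) = translate s (transport r f) := by
  simp only [transport_apply, map_add, part_translate, translate_translate, add_comm]

theorem transport_transport (r s : ℝ) (f : L2) :
    transport r (transport s f) = transport (r + s) f := by
  ext1
  filter_upwards [coeFn_transport r (transport s f), ae_comp_sub (coeFn_transport s f) r,
    ae_comp_add (coeFn_transport s f) r, coeFn_transport (r + s) f] with x h1 h2 h3 h4
  rw [h1, h2, h3, h4]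
  simp [sub_sub, add_assoc]

theorem transport_zero (f : L2) : transport 0 f = f := by
  ext1
  filter_upwards [coeFn_transport 0 f] with x hx
  rw [hx]
  ext j
  fin_cases j <;> simp

theorem norm_sq_transport (r : ℝ) (f : L2) :
    ‖transport r f‖ ^ 2 = ‖part 0 f‖ ^ 2 + ‖part 1 f‖ ^ 2 := by
  have horth : inner ℂ (translate r (part 0 f)) (translate (-r) (part 1 f)) = 0 := by
    rw [L2.inner_def]
    refine integral_eq_zero_of_ae ?_
    filter_upwards [coeFn_translate r (part 0 f), coeFn_translate (-r) (part 1 f),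
      ae_comp_sub (coeFn_part 0 f) r, ae_comp_sub (coeFn_part 1 f) (-r)] with x h1 h2 h3 h4
    rw [h1, h2, h3, h4]
    simp [PiLp.inner_apply, component_apply]
  have hpyth := norm_add_sq_eq_norm_sq_add_norm_sq_of_inner_eq_zero _ _ horth
  rw [LinearIsometry.norm_map, LinearIsometry.norm_map] at hpyth
  rw [transport_apply, pow_two, pow_two, pow_two, hpyth]

theorem norm_transport (r : ℝ) (f : L2) : ‖transport r f‖ = ‖f‖ := by
  rw [← pow_left_inj₀ (norm_nonneg _) (norm_nonneg _) two_ne_zero, norm_sq_transport,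
    ← norm_sq_transport 0, transport_zero]

theorem continuous_transport : Continuous fun q : ℝ × L2 => transport q.1 q.2 := by
  have htranslate : Continuous fun q : ℝ × L2 => translate q.1 q.2 :=
    continuous_translate ENNReal.ofNat_ne_top
  simp only [transport_apply]
  refine Continuous.add ?_ ?_
  · exact htranslate.comp (f := fun q : ℝ × L2 => (q.1, part 0 q.2)) (by fun_prop)
  · exact htranslate.comp (f := fun q : ℝ × L2 => (-q.1, part 1 q.2)) (by fun_prop)

/-- The action of `σ₃` on `L²`. -/
def sigmaThree : L2 →L[ℂ] L2 := part 0 - part 1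

theorem coeFn_sigmaThree (f : L2) :
    sigmaThree f =ᵐ[volume] fun x => act (pauli 3) (f x) := by
  filter_upwards [Lp.coeFn_sub (part 0 f) (part 1 f), coeFn_part 0 f, coeFn_part 1 f]
    with x h1 h2 h3
  rw [sigmaThree, sub_apply, h1, Pi.sub_apply, h2, h3]
  ext j
  fin_cases j <;> simp [component_apply, act, pauli, dotProduct]

theorem IsWeakDeriv.hasDerivAt_transport_neg {f g : L2} (h : IsWeakDeriv 1 f g) (r : ℝ) :
    HasDerivAt (fun r => transport (-r) f) (transport (-r) (sigmaThree g)) r := by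
  have hbackward : HasDerivAt (fun r => translate (-r) f) (translate (-r) g) r := by
    exact ((h.hasDerivAt_translate (-r)).scomp r (hasDerivAt_neg r)).congr_deriv (by simp)
  have hsum := (((part 0).restrictScalars ℝ).hasFDerivAt.comp_hasDerivAt r hbackward).add
    (((part 1).restrictScalars ℝ).hasFDerivAt.comp_hasDerivAt r (h.hasDerivAt_translate r))
  refine (hsum.congr_deriv ?_).congr_of_eventuallyEq (Eventually.of_forall fun s => ?_)
  · simp [transport_apply, sigmaThree, part_translate, part_part_self, part_part_of_ne]
  · simp [transport_apply, part_translate]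

/-! ### Fourier series on the band -/

section Band

variable {δ : ℝ}

theorem phase_mul_phase (r s η : ℝ) : phase r η * phase s η = phase (r + s) η := by
  rw [phase, phase, phase, ← Complex.exp_add, ← mul_add, ← Complex.ofReal_add]
  congr 3
  ring

theorem conj_phase (r η : ℝ) : (starRingEnd ℂ) (phase r η) = phase (-r) η := by
  rw [phase, phase, ← Complex.exp_conj, map_mul, Complex.conj_I, Complex.conj_ofReal, neg_mul,
    ← mul_neg, ← Complex.ofReal_neg]
  congr 3
  ring

theorem exp_eq_phase (δ η : ℝ) (n : ℤ) :
    Complex.exp (2 * Real.pi * Complex.I * (δ * n * η)) = phase (-(δ * n)) η := by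
  rw [phase]
  congr 1
  push_cast
  ring

theorem exp_neg_eq_phase (δ η : ℝ) (n : ℤ) :
    Complex.exp (-(2 * Real.pi * Complex.I * (δ * n * η))) = phase (δ * n) η := by
  rw [phase]
  congr 1
  push_cast
  ring

/-- The `n`-th Fourier coefficient of the restriction of `F` to the band. -/
def bandCoeff (δ : ℝ) (F : L2) (n : ℤ) : Spinor := ∫ η in band δ, phase (-(δ * n)) η • F η

theorem shannonInv_eq (δ : ℝ) (f : L2) : shannonInv δ f = bandCoeff δ (𝓕 f) := by
  ext1 n
  simp only [shannonInv, bandCoeff, exp_eq_phase]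

theorem integrableOn_phase_smul (r δ : ℝ) (F : L2) :
    IntegrableOn (fun η => phase r η • F η) (band δ) := by
  have : IsFiniteMeasure (volume.restrict (band δ)) := by unfold band; infer_instance
  exact ((memLp_phase_smul r F).restrict (band δ)).integrable one_le_two

theorem bandCoeff_sub (δ : ℝ) (F G : L2) (n : ℤ) :
    bandCoeff δ (F - G) n = bandCoeff δ F n - bandCoeff δ G n := by
  rw [bandCoeff, bandCoeff, bandCoeff,
    ← integral_sub (integrableOn_phase_smul _ δ F) (integrableOn_phase_smul _ δ G)]
  refine integral_congr_ae (ae_restrict_of_ae ?_)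
  filter_upwards [Lp.coeFn_sub F G] with η h
  rw [h, Pi.sub_apply, smul_sub]

theorem shannonInv_sub (δ : ℝ) (f g : L2) (n : ℤ) :
    shannonInv δ (f - g) n = shannonInv δ f n - shannonInv δ g n := by
  have hfourier : (𝓕 (f - g) : L2) = 𝓕 f - 𝓕 g := map_sub (Lp.fourierTransformₗᵢ ℝ Spinor) f g
  rw [shannonInv_eq, shannonInv_eq, shannonInv_eq, hfourier, bandCoeff_sub]

theorem shannonInv_translate (δ : ℝ) (f : L2) (n : ℤ) :
    shannonInv δ (translate δ f) n = shannonInv δ f (n - 1) := by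
  rw [shannonInv_eq, shannonInv_eq, bandCoeff, bandCoeff, fourier_translate]
  refine integral_congr_ae (ae_restrict_of_ae ?_)
  filter_upwards [coeFn_modulate δ (𝓕 f : L2)] with η h
  rw [h, smul_smul, phase_mul_phase]
  congr 2
  push_cast
  ring

theorem coeFn_latticeMode (δ : ℝ) (n : ℤ) (c : Spinor) :
    latticeMode δ n c =ᵐ[volume]
      (band δ).indicator fun η => ((δ : ℂ) * phase (δ * n) η) • c := by
  refine (memLp_latticeMode δ n c).coeFn_toLp.trans (Eventually.of_forall fun η => ?_)
  simp only [exp_neg_eq_phase]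

theorem inner_latticeMode (δ : ℝ) (n : ℤ) (c : Spinor) (F : L2) :
    inner ℂ (latticeMode δ n c) F = δ * inner ℂ c (bandCoeff δ F n) := by
  rw [L2.inner_def, bandCoeff, ← integral_inner (integrableOn_phase_smul _ δ F),
    ← integral_const_mul, ← integral_indicator (s := band δ) measurableSet_Icc]
  refine integral_congr_ae ?_
  filter_upwards [coeFn_latticeMode δ n c] with η h
  rw [h]
  by_cases hη : η ∈ band δ
  · rw [Set.indicator_of_mem hη, Set.indicator_of_mem hη, inner_smul_left, inner_smul_right,
      map_mul, conj_phase, Complex.conj_ofReal, mul_assoc]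
  · rw [Set.indicator_of_notMem hη, Set.indicator_of_notMem hη, inner_zero_left]

theorem integral_band_phase (hδ : 0 < δ) (k : ℤ) :
    ∫ η in band δ, phase (δ * k) η = if k = 0 then (δ : ℂ)⁻¹ else 0 := by
  have hδ' : (δ : ℂ) ≠ 0 := by exact_mod_cast hδ.ne'
  have hle : -(1 / (2 * δ)) ≤ 1 / (2 * δ) := by linarith [show 0 < 1 / (2 * δ) by positivity]
  rw [band, integral_Icc_eq_integral_Ioc, ← intervalIntegral.integral_of_le hle]
  split_ifs with hk
  · simp only [hk, phase, Int.cast_zero, mul_zero, zero_mul, neg_zero, Complex.ofReal_zero,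
      Complex.exp_zero, intervalIntegral.integral_const, sub_neg_eq_add, ← two_mul,
      Complex.real_smul, mul_one]
    push_cast
    field_simp
  · have hfreq : (-(2 * Real.pi * Complex.I * (δ * k)) : ℂ) ≠ 0 := by
      simp [hδ.ne', hk, Real.pi_ne_zero]
    have hphase (η : ℝ) :
        phase (δ * k) η = Complex.exp (-(2 * Real.pi * Complex.I * (δ * k)) * η) := by
      rw [← exp_neg_eq_phase]
      congr 1
      ring
    simp only [hphase]
    rw [integral_exp_mul_complex hfreq, div_eq_zero_iff, sub_eq_zero,
      Complex.exp_eq_exp_iff_exists_int]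
    refine .inl ⟨-k, ?_⟩
    push_cast
    field_simp
    ring

theorem bandCoeff_latticeMode (hδ : 0 < δ) (m n : ℤ) (c : Spinor) :
    bandCoeff δ (latticeMode δ m c) n = if m = n then c else 0 := by
  have hδ' : (δ : ℂ) ≠ 0 := by exact_mod_cast hδ.ne'
  have hintegrand : bandCoeff δ (latticeMode δ m c) n
      = ∫ η in band δ, ((δ : ℂ) * phase (δ * (m - n : ℤ)) η) • c := by
    refine setIntegral_congr_ae measurableSet_Icc ?_
    filter_upwards [coeFn_latticeMode δ m c] with η h hη
    rw [h, Set.indicator_of_mem hη, smul_smul, mul_left_comm, phase_mul_phase]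
    congr 3
    push_cast
    ring
  rw [hintegrand, integral_smul_const, integral_const_mul, integral_band_phase hδ]
  by_cases h : m = n
  · rw [if_pos h, if_pos (sub_eq_zero.2 h), mul_inv_cancel₀ hδ', one_smul]
  · rw [if_neg h, if_neg (sub_ne_zero.2 h), mul_zero, zero_smul]

theorem norm_sq_latticeMode (hδ : 0 < δ) (n : ℤ) (c : Spinor) :
    ‖latticeMode δ n c‖ ^ 2 = δ * ‖c‖ ^ 2 := by
  have h := inner_latticeMode δ n c (latticeMode δ n c)
  rw [bandCoeff_latticeMode hδ, if_pos rfl, inner_self_eq_norm_sq_to_K,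
    inner_self_eq_norm_sq_to_K] at h
  exact Complex.ofReal_injective (by push_cast; exact h)

theorem latticeMode_add (δ : ℝ) (n : ℤ) (c d : Spinor) :
    latticeMode δ n (c + d) = latticeMode δ n c + latticeMode δ n d := by
  rw [latticeMode, latticeMode, latticeMode, ← MemLp.toLp_add]
  refine MemLp.toLp_congr _ _ (Eventually.of_forall fun η => ?_)
  simp only [smul_add]
  exact congr_fun (Set.indicator_add (band δ) _ _) η

theorem latticeMode_smul (δ : ℝ) (n : ℤ) (z : ℂ) (c : Spinor) :
    latticeMode δ n (z • c) = z • latticeMode δ n c := by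
  rw [latticeMode, latticeMode, ← MemLp.toLp_const_smul]
  simp only [smul_comm _ z c, Set.indicator_const_smul]
  rfl

/-- The lattice mode at the `n`-th lattice point, normalised to an isometric embedding of `ℂ²`. -/
def latticeIsometry (hδ : 0 < δ) (n : ℤ) : Spinor →ₗᵢ[ℂ] L2 where
  toFun c := (((√δ)⁻¹ : ℝ) : ℂ) • latticeMode δ n c
  map_add' c d := by rw [latticeMode_add, smul_add]
  map_smul' z c := by rw [latticeMode_smul, smul_comm, RingHom.id_apply]
  norm_map' c := by
    change ‖(((√δ)⁻¹ : ℝ) : ℂ) • latticeMode δ n c‖ = ‖c‖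
    rw [← pow_left_inj₀ (norm_nonneg _) (norm_nonneg _) two_ne_zero, norm_smul, mul_pow,
      norm_sq_latticeMode hδ, Complex.norm_real, norm_inv, inv_pow, Real.norm_eq_abs, sq_abs,
      Real.sq_sqrt hδ.le, inv_mul_cancel_left₀ hδ.ne']

theorem latticeIsometry_apply (hδ : 0 < δ) (n : ℤ) (c : Spinor) :
    latticeIsometry hδ n c = (((√δ)⁻¹ : ℝ) : ℂ) • latticeMode δ n c := rfl

theorem latticeIsometry_sqrt_smul (hδ : 0 < δ) (n : ℤ) (c : Spinor) :
    latticeIsometry hδ n (((√δ : ℝ) : ℂ) • c) = latticeMode δ n c := by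
  rw [map_smul, latticeIsometry_apply, smul_smul, ← Complex.ofReal_mul,
    mul_inv_cancel₀ (Real.sqrt_pos.2 hδ).ne', Complex.ofReal_one, one_smul]

theorem orthogonalFamily_latticeIsometry (hδ : 0 < δ) :
    OrthogonalFamily ℂ (fun _ : ℤ => Spinor) (latticeIsometry hδ) := by
  intro m n hmn c d
  change inner ℂ (latticeIsometry hδ m c) (latticeIsometry hδ n d) = 0
  rw [latticeIsometry_apply, latticeIsometry_apply, inner_smul_left, inner_smul_right,
    inner_latticeMode, bandCoeff_latticeMode hδ, if_neg hmn.symm, inner_zero_right, mul_zero,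
    mul_zero, mul_zero]

theorem memℓp_two_iff {ι E : Type*} [NormedAddCommGroup E] {w : ι → E} :
    Memℓp w 2 ↔ Summable fun n => ‖w n‖ ^ 2 := by
  simp [memℓp_gen_iff]

theorem hasSum_latticeMode_linearIsometry (hδ : 0 < δ) (w : lp (fun _ : ℤ => Spinor) 2) :
    HasSum (fun n => latticeMode δ n (w n))
      ((orthogonalFamily_latticeIsometry hδ).linearIsometry (((√δ : ℝ) : ℂ) • w)) := by
  simpa only [lp.coeFn_smul, Pi.smul_apply, latticeIsometry_sqrt_smul] using
    (orthogonalFamily_latticeIsometry hδ).hasSum_linearIsometry (((√δ : ℝ) : ℂ) • w)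

variable {w w' : ℤ → Spinor}

theorem hasSum_latticeMode (hδ : 0 < δ) (hw : Summable fun n => ‖w n‖ ^ 2) :
    HasSum (fun n => latticeMode δ n (w n)) (discreteFourier δ w) :=
  (hasSum_latticeMode_linearIsometry hδ ⟨w, memℓp_two_iff.2 hw⟩).summable.hasSum

theorem norm_sq_discreteFourier (hδ : 0 < δ) (hw : Summable fun n => ‖w n‖ ^ 2) :
    ‖discreteFourier δ w‖ ^ 2 = δ * ∑' n, ‖w n‖ ^ 2 := by
  let v : lp (fun _ : ℤ => Spinor) 2 := ⟨w, memℓp_two_iff.2 hw⟩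
  have hv : ‖v‖ ^ 2 = ∑' n, ‖w n‖ ^ 2 := by
    simpa [v] using lp.norm_rpow_eq_tsum (p := 2) (by simp) v
  rw [(hasSum_latticeMode hδ hw).unique (hasSum_latticeMode_linearIsometry hδ v),
    LinearIsometry.norm_map, norm_smul, mul_pow, hv, Complex.norm_real, Real.norm_eq_abs, sq_abs,
    Real.sq_sqrt hδ.le]

theorem summable_norm_sq_sub {ι E : Type*} [NormedAddCommGroup E] {v w : ι → E}
    (hv : Summable fun n => ‖v n‖ ^ 2) (hw : Summable fun n => ‖w n‖ ^ 2) :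
    Summable fun n => ‖v n - w n‖ ^ 2 :=
  memℓp_two_iff.1 ((memℓp_two_iff.2 hv).sub (memℓp_two_iff.2 hw))

theorem discreteFourier_sub (hδ : 0 < δ) (hw : Summable fun n => ‖w n‖ ^ 2)
    (hw' : Summable fun n => ‖w' n‖ ^ 2) :
    discreteFourier δ (w - w') = discreteFourier δ w - discreteFourier δ w' := by
  refine (hasSum_latticeMode hδ (summable_norm_sq_sub hw hw')).unique ?_
  convert (hasSum_latticeMode hδ hw).sub (hasSum_latticeMode hδ hw') using 2 with n
  rw [eq_sub_iff_add_eq, ← latticeMode_add, sub_add_cancel]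

theorem norm_sq_shannon_sub (hδ : 0 < δ) (hw : Summable fun n => ‖w n‖ ^ 2)
    (hw' : Summable fun n => ‖w' n‖ ^ 2) :
    ‖shannon δ w - shannon δ w'‖ ^ 2 = δ * ∑' n, ‖w n - w' n‖ ^ 2 := by
  have hfourier : shannon δ w - shannon δ w' = 𝓕⁻ (discreteFourier δ (w - w')) := by
    rw [discreteFourier_sub hδ hw hw']
    exact (map_sub (Lp.fourierTransformₗᵢ ℝ Spinor).symm _ _).symm
  have hnorm : ‖(𝓕⁻ (discreteFourier δ (w - w')) : L2)‖ = ‖discreteFourier δ (w - w')‖ :=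
    (Lp.fourierTransformₗᵢ ℝ Spinor).symm.norm_map _
  rw [hfourier, hnorm]
  exact norm_sq_discreteFourier hδ (summable_norm_sq_sub hw hw')

theorem bandCoeff_apply (δ : ℝ) (F : L2) (n : ℤ) (i : Fin 2) :
    bandCoeff δ F n i = ∫ η in band δ, phase (-(δ * n)) η • F η i :=
  ((EuclideanSpace.proj i : Spinor →L[ℂ] ℂ).integral_comp_comm
    (integrableOn_phase_smul _ δ F)).symm

theorem hasSum_norm_sq_bandCoeff_apply (hδ : 0 < δ) (F : L2) (i : Fin 2) :
    HasSum (fun n => δ * ‖bandCoeff δ F n i‖ ^ 2) (∫ η in band δ, ‖F η i‖ ^ 2) := by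
  have hlt : -(1 / (2 * δ)) < 1 / (2 * δ) := by linarith [show 0 < 1 / (2 * δ) by positivity]
  have hlen : 1 / (2 * δ) - -(1 / (2 * δ)) = δ⁻¹ := by field_simp; norm_num
  have hmem : MemLp (fun η => F η i) 2 (volume.restrict (Set.Ioc (-(1 / (2 * δ))) (1 / (2 * δ)))) :=
    ((EuclideanSpace.proj i : Spinor →L[ℂ] ℂ).comp_memLp' (Lp.memLp F)).restrict _
  have hcoeff (n : ℤ) : fourierCoeffOn hlt (fun η => F η i) (-n) = (δ : ℂ) * bandCoeff δ F n i := by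
    rw [fourierCoeffOn_eq_integral, bandCoeff_apply, band, integral_Icc_eq_integral_Ioc,
      ← intervalIntegral.integral_of_le hlt.le, hlen, one_div, inv_inv, Complex.real_smul]
    congr 1
    refine intervalIntegral.integral_congr fun η _ => ?_
    simp only [neg_neg, fourier_coe_apply, ← exp_eq_phase]
    congr 2
    push_cast
    rw [div_inv_eq_mul]
    ring
  have hparseval := ((Equiv.neg ℤ).hasSum_iff.2 (hasSum_sq_fourierCoeffOn hlt hmem)).mul_left δ⁻¹
  rw [hlen, inv_inv, intervalIntegral.integral_of_le hlt.le, ← integral_Icc_eq_integral_Ioc,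
    smul_eq_mul, inv_mul_cancel_left₀ hδ.ne'] at hparseval
  refine hparseval.congr_fun fun n => ?_
  rw [Function.comp_apply, Equiv.neg_apply, hcoeff, norm_mul, Complex.norm_real,
    Real.norm_of_nonneg hδ.le]
  field_simp

theorem hasSum_norm_sq_bandCoeff (hδ : 0 < δ) (F : L2) :
    HasSum (fun n => δ * ‖bandCoeff δ F n‖ ^ 2) (∫ η in band δ, ‖F η‖ ^ 2) := by
  have hsq (i : Fin 2) : IntegrableOn (fun η => ‖F η i‖ ^ 2) (band δ) := by
    have hmem := (EuclideanSpace.proj i : Spinor →L[ℂ] ℂ).comp_memLp' (Lp.memLp F)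
    exact ((memLp_two_iff_integrable_sq_norm hmem.1).1 hmem).integrableOn
  have h := (hasSum_norm_sq_bandCoeff_apply hδ F 0).add (hasSum_norm_sq_bandCoeff_apply hδ F 1)
  rw [← integral_add (hsq 0) (hsq 1)] at h
  simpa only [EuclideanSpace.norm_sq_eq, Fin.sum_univ_two, mul_add] using h

theorem summable_norm_sq_bandCoeff (hδ : 0 < δ) (F : L2) :
    Summable fun n => ‖bandCoeff δ F n‖ ^ 2 := by
  simpa only [inv_mul_cancel_left₀ hδ.ne'] using
    (hasSum_norm_sq_bandCoeff hδ F).summable.mul_left δ⁻¹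

theorem summable_norm_sq_shannonInv (hδ : 0 < δ) (f : L2) :
    Summable fun n => ‖shannonInv δ f n‖ ^ 2 := by
  rw [shannonInv_eq]
  exact summable_norm_sq_bandCoeff hδ _

/-- The restriction of an `L²` function to the band, extended by zero. -/
def cutoff (δ : ℝ) (F : L2) : L2 := ((Lp.memLp F).indicator (s := band δ) measurableSet_Icc).toLp _

theorem coeFn_cutoff (δ : ℝ) (F : L2) : cutoff δ F =ᵐ[volume] (band δ).indicator F :=
  ((Lp.memLp F).indicator (s := band δ) measurableSet_Icc).coeFn_toLp

theorem bandProj_eq (δ : ℝ) (f : L2) : bandProj δ f = 𝓕⁻ (cutoff δ (𝓕 f)) := rfl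

theorem cutoff_sub (δ : ℝ) (F G : L2) : cutoff δ (F - G) = cutoff δ F - cutoff δ G := by
  ext1
  filter_upwards [coeFn_cutoff δ (F - G), coeFn_cutoff δ F, coeFn_cutoff δ G,
    Lp.coeFn_sub F G, Lp.coeFn_sub (cutoff δ F) (cutoff δ G)] with η h1 h2 h3 h4 h5
  rw [h1, h5, Pi.sub_apply, h2, h3]
  by_cases hη : η ∈ band δ
  · rw [Set.indicator_of_mem hη, Set.indicator_of_mem hη, Set.indicator_of_mem hη, h4, Pi.sub_apply]
  · rw [Set.indicator_of_notMem hη, Set.indicator_of_notMem hη, Set.indicator_of_notMem hη,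
      sub_zero]

theorem norm_cutoff_le (δ : ℝ) (F : L2) : ‖cutoff δ F‖ ≤ ‖F‖ := by
  refine Lp.norm_le_norm_of_ae_le ?_
  filter_upwards [coeFn_cutoff δ F] with η h
  rw [h]
  exact norm_indicator_le_norm_self _ _

theorem norm_sq_cutoff (δ : ℝ) (F : L2) : ‖cutoff δ F‖ ^ 2 = ∫ η in band δ, ‖F η‖ ^ 2 := by
  rw [norm_sq_eq_integral, ← integral_indicator (s := band δ) measurableSet_Icc]
  refine integral_congr_ae ?_
  filter_upwards [coeFn_cutoff δ F] with η h
  rw [h]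
  by_cases hη : η ∈ band δ
  · rw [Set.indicator_of_mem hη, Set.indicator_of_mem hη]
  · rw [Set.indicator_of_notMem hη, Set.indicator_of_notMem hη, norm_zero, zero_pow two_ne_zero]

theorem tsum_norm_sq_shannonInv_le (hδ : 0 < δ) (f : L2) :
    δ * ∑' n, ‖shannonInv δ f n‖ ^ 2 ≤ ‖f‖ ^ 2 := by
  rw [← tsum_mul_left, shannonInv_eq, (hasSum_norm_sq_bandCoeff hδ (𝓕 f)).tsum_eq,
    ← norm_sq_cutoff, ← Lp.norm_fourier_eq f]
  gcongr
  exact norm_cutoff_le δ _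

theorem bandCoeff_cutoff (δ : ℝ) (F : L2) (n : ℤ) :
    bandCoeff δ (cutoff δ F) n = bandCoeff δ F n := by
  refine setIntegral_congr_ae measurableSet_Icc ?_
  filter_upwards [coeFn_cutoff δ F] with η h hη
  rw [h, Set.indicator_of_mem hη]

theorem shannonInv_bandProj (δ : ℝ) (f : L2) : shannonInv δ (bandProj δ f) = shannonInv δ f := by
  ext1 n
  rw [shannonInv_eq, shannonInv_eq, bandProj_eq, FourierTransform.fourier_fourierInv_eq,
    bandCoeff_cutoff]

theorem inner_discreteFourier_bandCoeff (hδ : 0 < δ) (F : L2) :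
    inner ℂ (discreteFourier δ (bandCoeff δ F)) (cutoff δ F) = ((‖cutoff δ F‖ ^ 2 : ℝ) : ℂ) := by
  have hsum : HasSum (fun n => ((δ * ‖bandCoeff δ F n‖ ^ 2 : ℝ) : ℂ))
      (inner ℂ (discreteFourier δ (bandCoeff δ F)) (cutoff δ F)) := by
    refine (((innerSL ℂ).flip (cutoff δ F)).hasSum
      (hasSum_latticeMode hδ (summable_norm_sq_bandCoeff hδ F))).congr_fun fun n => ?_
    change _ = inner ℂ (latticeMode δ n (bandCoeff δ F n)) (cutoff δ F)
    rw [inner_latticeMode, bandCoeff_cutoff, inner_self_eq_norm_sq_to_K]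
    simp
  rw [norm_sq_cutoff]
  exact hsum.unique (Complex.hasSum_ofReal.2 (hasSum_norm_sq_bandCoeff hδ F))

theorem discreteFourier_bandCoeff (hδ : 0 < δ) (F : L2) :
    discreteFourier δ (bandCoeff δ F) = cutoff δ F := by
  have hnorm : ‖discreteFourier δ (bandCoeff δ F)‖ ^ 2 = ‖cutoff δ F‖ ^ 2 := by
    rw [norm_sq_discreteFourier hδ (summable_norm_sq_bandCoeff hδ F), norm_sq_cutoff,
      ← (hasSum_norm_sq_bandCoeff hδ F).tsum_eq, tsum_mul_left]
  rw [← sub_eq_zero, ← norm_eq_zero, ← sq_eq_zero_iff, @norm_sub_sq ℂ,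
    inner_discreteFourier_bandCoeff hδ, RCLike.re_to_complex, Complex.ofReal_re, hnorm]
  ring

theorem shannon_shannonInv (hδ : 0 < δ) (f : L2) : shannon δ (shannonInv δ f) = bandProj δ f := by
  rw [shannon, shannonInv_eq, discreteFourier_bandCoeff hδ, bandProj_eq]

theorem norm_bandProj_le (δ : ℝ) (f : L2) : ‖bandProj δ f‖ ≤ ‖f‖ :=
  ((Lp.fourierTransformₗᵢ ℝ Spinor).symm.norm_map _).trans_le
    ((norm_cutoff_le δ _).trans_eq (Lp.norm_fourier_eq f))

theorem bandProj_sub (δ : ℝ) (f g : L2) : bandProj δ (f - g) = bandProj δ f - bandProj δ g := by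
  let 𝓕ₗ := Lp.fourierTransformₗᵢ ℝ Spinor
  have hcutoff : cutoff δ (𝓕 (f - g)) = cutoff δ (𝓕 f) - cutoff δ (𝓕 g) :=
    (congr_arg (cutoff δ) (map_sub 𝓕ₗ f g)).trans (cutoff_sub δ _ _)
  rw [bandProj_eq, hcutoff]
  exact map_sub 𝓕ₗ.symm _ _

end Band

/-! ### Step functions and samples -/

section StepFunctions

variable {E : Type*} [NormedAddCommGroup E] {δ : ℝ} {w w' : ℤ → E}

theorem measurable_floor_div (δ : ℝ) : Measurable fun x : ℝ => ⌊x / δ⌋ :=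
  Int.measurable_floor.comp (measurable_id.div_const δ)

theorem map_floor_div (hδ : 0 < δ) :
    Measure.map (fun x : ℝ => ⌊x / δ⌋) volume = ENNReal.ofReal δ • Measure.count := by
  refine Measure.ext_of_singleton fun n => ?_
  rw [Measure.map_apply (measurable_floor_div δ) (measurableSet_singleton n)]
  have hpreimage : (fun x : ℝ => ⌊x / δ⌋) ⁻¹' {n} = Set.Ico (n * δ) ((n + 1) * δ) := by
    ext x
    rw [Set.mem_preimage, Set.mem_singleton_iff, Int.floor_eq_iff, le_div_iff₀ hδ,
      div_lt_iff₀ hδ, Set.mem_Ico]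
  rw [hpreimage, Real.volume_Ico, add_one_mul, add_sub_cancel_left]
  simp

theorem memLp_step (hδ : 0 < δ) (hw : Summable fun n => ‖w n‖ ^ 2) :
    MemLp (fun x : ℝ => w ⌊x / δ⌋) 2 volume := by
  have hmem : MemLp w 2 (Measure.map (fun x : ℝ => ⌊x / δ⌋) volume) := by
    rw [map_floor_div hδ]
    refine MemLp.smul_measure ?_ ENNReal.ofReal_ne_top
    rw [memLp_two_iff_integrable_sq_norm StronglyMeasurable.of_discrete.aestronglyMeasurable,
      integrable_count_iff]
    simpa using hw
  exact hmem.comp_of_map (measurable_floor_div δ).aemeasurable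

open Classical in
/-- The step function `x ↦ w ⌊x / δ⌋` as an element of `L²(ℝ, E)`; zero if it is not square
integrable. -/
def step (δ : ℝ) (w : ℤ → E) : Lp E 2 (volume : Measure ℝ) :=
  if h : MemLp (fun x : ℝ => w ⌊x / δ⌋) 2 volume then h.toLp else 0

theorem coeFn_step (hδ : 0 < δ) (hw : Summable fun n => ‖w n‖ ^ 2) :
    step δ w =ᵐ[volume] fun x => w ⌊x / δ⌋ := by
  rw [step, dif_pos (memLp_step hδ hw)]
  exact MemLp.coeFn_toLp _

theorem norm_sq_step (hδ : 0 < δ) (hw : Summable fun n => ‖w n‖ ^ 2) :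
    ‖step δ w‖ ^ 2 = δ * ∑' n, ‖w n‖ ^ 2 := by
  have hsq : Integrable (fun n => ‖w n‖ ^ 2) (ENNReal.ofReal δ • (Measure.count : Measure ℤ)) := by
    refine Integrable.smul_measure ?_ ENNReal.ofReal_ne_top
    rw [integrable_count_iff]
    simpa using hw
  calc ‖step δ w‖ ^ 2 = ∫ x, ‖w ⌊x / δ⌋‖ ^ 2 := by
        rw [norm_sq_eq_integral]
        refine integral_congr_ae ?_
        filter_upwards [coeFn_step hδ hw] with x hx
        rw [hx]
    _ = ∫ n, ‖w n‖ ^ 2 ∂(Measure.map (fun x : ℝ => ⌊x / δ⌋) volume) :=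
        (integral_map (f := fun n => ‖w n‖ ^ 2) (measurable_floor_div δ).aemeasurable
          StronglyMeasurable.of_discrete.aestronglyMeasurable).symm
    _ = ∑' n, δ * ‖w n‖ ^ 2 := by
        rw [map_floor_div hδ, integral_countable hsq]
        simp [Measure.real, hδ.le]
    _ = δ * ∑' n, ‖w n‖ ^ 2 := tsum_mul_left

theorem step_sub (hδ : 0 < δ) (hw : Summable fun n => ‖w n‖ ^ 2)
    (hw' : Summable fun n => ‖w' n‖ ^ 2) : step δ (w - w') = step δ w - step δ w' := by
  have hsub : Summable fun n => ‖(w - w') n‖ ^ 2 := summable_norm_sq_sub hw hw'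
  ext1
  filter_upwards [coeFn_step hδ hw, coeFn_step hδ hw', Lp.coeFn_sub (step δ w) (step δ w'),
    coeFn_step (w := w - w') hδ hsub] with x h1 h2 h3 h4
  rw [h3, Pi.sub_apply, h1, h2, h4, Pi.sub_apply]

theorem summable_norm_sq_sub_one (hw : Summable fun n => ‖w n‖ ^ 2) :
    Summable fun n => ‖w (n - 1)‖ ^ 2 :=
  (Equiv.subRight (1 : ℤ)).summable_iff.2 hw

theorem summable_norm_sq_add_one (hw : Summable fun n => ‖w n‖ ^ 2) :
    Summable fun n => ‖w (n + 1)‖ ^ 2 :=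
  (Equiv.addRight (1 : ℤ)).summable_iff.2 hw

theorem floor_sub_div (hδ : 0 < δ) (x : ℝ) : ⌊(x - δ) / δ⌋ = ⌊x / δ⌋ - 1 := by
  rw [sub_div, div_self hδ.ne', Int.floor_sub_one]

theorem floor_add_div (hδ : 0 < δ) (x : ℝ) : ⌊(x + δ) / δ⌋ = ⌊x / δ⌋ + 1 := by
  rw [add_div, div_self hδ.ne', Int.floor_add_one]

theorem floor_div_mul_le (hδ : 0 < δ) (x : ℝ) : ⌊x / δ⌋ * δ ≤ x :=
  (le_div_iff₀ hδ).1 (Int.floor_le _)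

theorem lt_floor_div_add_one_mul (hδ : 0 < δ) (x : ℝ) : x < (⌊x / δ⌋ + 1) * δ :=
  (div_lt_iff₀ hδ).1 (Int.lt_floor_add_one _)

theorem translate_step [NormedSpace ℂ E] (hδ : 0 < δ) (hw : Summable fun n => ‖w n‖ ^ 2) :
    translate δ (step δ w) = step δ fun n => w (n - 1) := by
  ext1
  filter_upwards [coeFn_translate δ (step δ w), ae_comp_sub (coeFn_step hδ hw) δ,
    coeFn_step hδ (summable_norm_sq_sub_one hw)] with x h1 h2 h3
  rw [h1, h2, h3, floor_sub_div hδ]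

theorem norm_sub_sq_le_mul_tsum (hw : Summable fun n => ‖w (n - 1) - w n‖ ^ 2) (n : ℤ) (k : ℕ) :
    ‖w (n + k) - w n‖ ^ 2 ≤ k * ∑' j, ‖w (j - 1) - w j‖ ^ 2 := by
  have hinj : Function.Injective fun j : ℕ => n + (j : ℤ) + 1 := fun i j hij => by
    simp only at hij; omega
  have htelescope : w (n + k) - w n = ∑ j ∈ Finset.range k, (w (n + j + 1) - w (n + j)) := by
    simpa [add_assoc] using (Finset.sum_range_sub (fun j : ℕ => w (n + j)) k).symm
  have hpartial : ∑ j ∈ Finset.range k, ‖w (n + j + 1) - w (n + j)‖ ^ 2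
      ≤ ∑' j, ‖w (j - 1) - w j‖ ^ 2 := by
    have h := hw.sum_le_tsum ((Finset.range k).map ⟨_, hinj⟩) fun _ _ => by positivity
    simpa only [Finset.sum_map, Function.Embedding.coeFn_mk, add_sub_cancel_right,
      norm_sub_rev (w (n + _))] using h
  calc ‖w (n + k) - w n‖ ^ 2
      ≤ (∑ j ∈ Finset.range k, ‖w (n + j + 1) - w (n + j)‖) ^ 2 := by
        rw [htelescope]
        gcongr
        exact norm_sum_le _ _
    _ ≤ k * ∑ j ∈ Finset.range k, ‖w (n + j + 1) - w (n + j)‖ ^ 2 := by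
        simpa using sq_sum_le_card_mul_sum_sq (s := Finset.range k)
          (f := fun j : ℕ => ‖w (n + j + 1) - w (n + j)‖)
    _ ≤ k * ∑' j, ‖w (j - 1) - w j‖ ^ 2 := by gcongr

theorem norm_sub_le_of_norm_translate_step_sub_le [NormedSpace ℂ E] (hδ : 0 < δ)
    (hw : Summable fun n => ‖w n‖ ^ 2) {M : ℝ} (hM : ‖translate δ (step δ w) - step δ w‖ ≤ M * δ)
    (n : ℤ) (k : ℕ) : ‖w (n + k) - w n‖ ≤ M * √(k * δ) := by
  have hM_nonneg : 0 ≤ M := nonneg_of_mul_nonneg_left ((norm_nonneg _).trans hM) hδ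
  have hdiff := summable_norm_sq_sub (summable_norm_sq_sub_one hw) hw
  have hsum : δ * ∑' n, ‖w (n - 1) - w n‖ ^ 2 ≤ δ * (M ^ 2 * δ) := by
    calc δ * ∑' n, ‖w (n - 1) - w n‖ ^ 2 = ‖translate δ (step δ w) - step δ w‖ ^ 2 := by
          rw [translate_step hδ hw, ← step_sub hδ (summable_norm_sq_sub_one hw) hw]
          exact (norm_sq_step hδ hdiff).symm
      _ ≤ (M * δ) ^ 2 := by gcongr
      _ = δ * (M ^ 2 * δ) := by ring
  rw [← sq_le_sq₀ (norm_nonneg _) (by positivity), mul_pow, Real.sq_sqrt (by positivity)]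
  calc ‖w (n + k) - w n‖ ^ 2 ≤ k * ∑' j, ‖w (j - 1) - w j‖ ^ 2 := norm_sub_sq_le_mul_tsum hdiff n k
    _ ≤ k * (M ^ 2 * δ) := by gcongr; exact le_of_mul_le_mul_left hsum hδ
    _ = M ^ 2 * (k * δ) := by ring

theorem sq_mul_measureReal_le_norm_sq {α : Type*} [MeasurableSpace α] {μ : Measure α} {s : Set α}
    (hs : MeasurableSet s) (hμs : μ s ≠ ⊤) (f : Lp E 2 μ) {c : ℝ} (hc : 0 ≤ c)
    (hf : ∀ᵐ x ∂μ, x ∈ s → c ≤ ‖f x‖) : c ^ 2 * μ.real s ≤ ‖f‖ ^ 2 := by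
  calc c ^ 2 * μ.real s = ∫ _ in s, c ^ 2 ∂μ := by rw [setIntegral_const, smul_eq_mul, mul_comm]
    _ ≤ ∫ x in s, ‖f x‖ ^ 2 ∂μ := by
        refine setIntegral_mono_on_ae (integrableOn_const hμs) (integrable_norm_sq f).integrableOn
          hs ?_
        filter_upwards [hf] with x hx hxs
        have := hx hxs
        gcongr
    _ ≤ ∫ x, ‖f x‖ ^ 2 ∂μ := setIntegral_le_integral (integrable_norm_sq f)
        (Eventually.of_forall fun _ => by positivity)
    _ = ‖f‖ ^ 2 := (norm_sq_eq_integral f).symm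

/-- A lattice function with difference quotients bounded in `ℓ²` varies little on an interval of
small length `ℓ`: if it were large at one point, it would be far in `L²` from every function that
is bounded by `R`. -/
theorem norm_apply_le_of_norm_step_sub_lt [NormedSpace ℂ E] (hδ : 0 < δ)
    (hw : Summable fun n => ‖w n‖ ^ 2) {M R c ℓ : ℝ} (hc : 0 ≤ c) (hℓ : 0 < ℓ)
    (hM : ‖translate δ (step δ w) - step δ w‖ ≤ M * δ) {f : Lp E 2 (volume : Measure ℝ)}
    (hf : ∀ᵐ x, ‖f x‖ ≤ R) (hwf : ‖step δ w - f‖ < c * √ℓ) (n : ℤ) : ‖w n‖ ≤ R + c + M * √ℓ := by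
  by_contra! hlt
  have hM_nonneg : 0 ≤ M := nonneg_of_mul_nonneg_left ((norm_nonneg _).trans hM) hδ
  have hosc (x : ℝ) (hx : x ∈ Set.Ico (n * δ) (n * δ + ℓ)) : ‖w ⌊x / δ⌋ - w n‖ ≤ M * √ℓ := by
    have hfloor : n ≤ ⌊x / δ⌋ := by
      rw [Int.le_floor, le_div_iff₀ hδ]
      exact hx.1
    obtain ⟨k, hk⟩ := Int.le.dest hfloor
    have hkℓ : k * δ ≤ ℓ := by
      have hle := floor_div_mul_le hδ x
      rw [← hk] at hle
      push_cast at hle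
      linarith [hx.2]
    rw [← hk]
    exact (norm_sub_le_of_norm_translate_step_sub_le hδ hw hM n k).trans (by gcongr)
  have hfar : ∀ᵐ x, x ∈ Set.Ico (n * δ) (n * δ + ℓ) → c ≤ ‖(step δ w - f : Lp E 2 volume) x‖ := by
    filter_upwards [hf, coeFn_step hδ hw, Lp.coeFn_sub (step δ w) f] with x hfx hstep hsub hx
    rw [hsub, Pi.sub_apply, hstep]
    have htriangle := norm_sub_norm_le (w n) (w ⌊x / δ⌋)
    rw [norm_sub_rev] at htriangle
    linarith [norm_sub_norm_le (w ⌊x / δ⌋) (f x), hosc x hx]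
  have hlarge := sq_mul_measureReal_le_norm_sq measurableSet_Ico measure_Ico_lt_top.ne _ hc hfar
  rw [Real.volume_real_Ico_of_le (by linarith), add_sub_cancel_left] at hlarge
  have hsmall : ‖step δ w - f‖ ^ 2 < (c * √ℓ) ^ 2 := by gcongr
  rw [mul_pow, Real.sq_sqrt hℓ.le] at hsmall
  exact hsmall.not_ge hlarge

end StepFunctions

section Samples

variable {δ : ℝ} {w w' : ℤ → Spinor}

theorem norm_shannon_sub (hδ : 0 < δ) (hw : Summable fun n => ‖w n‖ ^ 2)
    (hw' : Summable fun n => ‖w' n‖ ^ 2) :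
    ‖shannon δ w - shannon δ w'‖ = ‖step δ w - step δ w'‖ := by
  rw [← pow_left_inj₀ (norm_nonneg _) (norm_nonneg _) two_ne_zero, norm_sq_shannon_sub hδ hw hw',
    ← step_sub hδ hw hw']
  exact (norm_sq_step hδ (summable_norm_sq_sub hw hw')).symm

theorem summable_norm_sq_shift (hw : Summable fun n => ‖w n‖ ^ 2) :
    Summable fun n => ‖shift w n‖ ^ 2 := by
  refine Summable.of_nonneg_of_le (fun n => by positivity) (fun n => ?_)
    ((summable_norm_sq_sub_one hw).add (summable_norm_sq_add_one hw))
  simp only [EuclideanSpace.norm_sq_eq, Fin.sum_univ_two, shift, Matrix.cons_val_zero,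
    Matrix.cons_val_one]
  linarith [sq_nonneg ‖w (n - 1) 1‖, sq_nonneg ‖w (n + 1) 0‖]

theorem transport_step (hδ : 0 < δ) (hw : Summable fun n => ‖w n‖ ^ 2) :
    transport δ (step δ w) = step δ (shift w) := by
  ext1
  filter_upwards [coeFn_transport δ (step δ w), ae_comp_sub (coeFn_step hδ hw) δ,
    ae_comp_add (coeFn_step hδ hw) δ, coeFn_step hδ (summable_norm_sq_shift hw)] with x h1 h2 h3 h4
  rw [h1, h2, h3, h4, floor_sub_div hδ, floor_add_div hδ, shift]

/-- The step function of the Shannon samples `I_δ⁻¹ j_δ f`. -/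
def sample (δ : ℝ) (f : L2) : L2 := step δ (shannonInv δ f)

theorem norm_sample_le (hδ : 0 < δ) (f : L2) : ‖sample δ f‖ ≤ ‖f‖ := by
  rw [← sq_le_sq₀ (norm_nonneg _) (norm_nonneg _), sample,
    norm_sq_step hδ (summable_norm_sq_shannonInv hδ f)]
  exact tsum_norm_sq_shannonInv_le hδ f

theorem sample_sub (hδ : 0 < δ) (f g : L2) : sample δ (f - g) = sample δ f - sample δ g := by
  rw [sample, sample, sample, ← step_sub hδ (summable_norm_sq_shannonInv hδ f)
    (summable_norm_sq_shannonInv hδ g)]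
  congr 1
  exact funext (shannonInv_sub δ f g)

theorem translate_sample (hδ : 0 < δ) (f : L2) :
    translate δ (sample δ f) = sample δ (translate δ f) := by
  rw [sample, translate_step hδ (summable_norm_sq_shannonInv hδ f), sample]
  congr 1
  exact (funext (shannonInv_translate δ f)).symm

theorem IsWeakDeriv.norm_translate_sample_sub_le (hδ : 0 < δ) {f g : L2} (h : IsWeakDeriv 1 f g) :
    ‖translate δ (sample δ f) - sample δ f‖ ≤ ‖g‖ * δ := by
  rw [translate_sample hδ, ← sample_sub hδ]
  refine (norm_sample_le hδ _).trans ?_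
  simpa only [abs_of_pos hδ] using h.norm_translate_sub_le δ

/-- The `L²` functions whose Fourier transform is smooth and compactly supported. -/
def bandLimited : Set L2 :=
  {f | ∃ ψ : 𝓢(ℝ, Spinor), HasCompactSupport ψ ∧ (𝓕 f : L2) = ψ.toLp 2}

theorem dense_bandLimited : Dense bandLimited := by
  let 𝓕ₗ := Lp.fourierTransformₗᵢ ℝ Spinor
  have hdense := 𝓕ₗ.symm.surjective.denseRange.dense_image 𝓕ₗ.symm.continuous
    (Lp.dense_hasCompactSupport_contDiff (E := ℝ) (F := Spinor) (μ := volume)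
      (ENNReal.ofNat_ne_top (n := 2)))
  refine hdense.mono ?_
  rintro _ ⟨F, ⟨ψ, hFψ, hsupport, hsmooth⟩, rfl⟩
  refine ⟨hsupport.toSchwartzMap hsmooth, hsupport, (𝓕ₗ.apply_symm_apply F).trans ?_⟩
  ext1
  filter_upwards [hFψ, (hsupport.toSchwartzMap hsmooth).coeFn_toLp 2 volume] with x h1 h2
  rw [h1, h2]
  rfl

theorem eventually_support_subset_band {E : Type*} [Zero E] {φ : ℝ → E}
    (h : HasCompactSupport φ) : ∀ᶠ δ in 𝓝[>] 0, Function.support φ ⊆ band δ := by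
  obtain ⟨r, hr⟩ := h.isBounded.subset_closedBall 0
  have hlim : Tendsto (fun δ : ℝ => 1 / (2 * δ)) (𝓝[>] 0) atTop := by
    refine (tendsto_inv_nhdsGT_zero.const_mul_atTop (one_half_pos (α := ℝ))).congr fun δ => ?_
    rw [one_div_mul_eq_div, one_div, mul_inv, div_eq_inv_mul]
  filter_upwards [hlim.eventually_ge_atTop r] with δ hδ
  refine (subset_tsupport φ).trans (hr.trans ?_)
  rw [Real.closedBall_eq_Icc, zero_sub, zero_add]
  exact Set.Icc_subset_Icc (neg_le_neg hδ) hδ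

theorem tendsto_bandProj {f : L2} (hf : f ∈ bandLimited) :
    Tendsto (fun δ => bandProj δ f) (𝓝[>] 0) (𝓝 f) := by
  obtain ⟨ψ, hsupport, hψ⟩ := hf
  refine tendsto_const_nhds.congr' ?_
  filter_upwards [eventually_support_subset_band hsupport] with δ hband
  have hcutoff : cutoff δ (𝓕 f) = 𝓕 f := by
    rw [hψ]
    ext1
    filter_upwards [coeFn_cutoff δ (ψ.toLp 2), ψ.coeFn_toLp 2 volume] with η h1 h2
    by_cases hη : η ∈ band δ
    · rw [h1, Set.indicator_of_mem hη]
    · rw [h1, Set.indicator_of_notMem hη, h2, Function.notMem_support.1 fun h => hη (hband h)]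
  rw [bandProj_eq, hcutoff, FourierTransform.fourierInv_fourier_eq]

theorem shannonInv_of_support_subset_band {f : L2} {ψ : 𝓢(ℝ, Spinor)}
    (hψ : (𝓕 f : L2) = ψ.toLp 2) (hband : Function.support ψ ⊆ band δ) (n : ℤ) :
    shannonInv δ f n = (𝓕⁻ ψ) (δ * n) := by
  rw [shannonInv_eq, bandCoeff, hψ, SchwartzMap.fourierInv_coe, Real.fourierInv_eq',
    ← setIntegral_eq_integral_of_forall_compl_eq_zero (s := band δ)
    (f := fun v : ℝ => Complex.exp _ • ψ v)]
  · refine setIntegral_congr_ae measurableSet_Icc ?_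
    filter_upwards [ψ.coeFn_toLp 2 volume] with η h _
    rw [h, ← exp_eq_phase]
    congr 2
    simp only [RCLike.inner_apply, conj_trivial, Complex.ofReal_mul, Complex.ofReal_ofNat,
      Complex.ofReal_intCast]
    ring
  · intro η hη
    rw [Function.notMem_support.1 fun h => hη (hband h), smul_zero]

theorem exists_norm_deriv_schwartz_le {E : Type*} [NormedAddCommGroup E] [NormedSpace ℝ E]
    (φ : 𝓢(ℝ, E)) : ∃ C, ∀ x, ‖deriv φ x‖ ≤ C * (1 + x ^ 2)⁻¹ := by
  obtain ⟨C₀, -, h₀⟩ := φ.decay 0 1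
  obtain ⟨C₂, -, h₂⟩ := φ.decay 2 1
  refine ⟨C₀ + C₂, fun x => ?_⟩
  have hbound₀ := h₀ x
  have hbound₂ := h₂ x
  rw [norm_iteratedFDeriv_eq_norm_iteratedDeriv, iteratedDeriv_one] at hbound₀ hbound₂
  rw [pow_zero, one_mul] at hbound₀
  rw [Real.norm_eq_abs, sq_abs] at hbound₂
  rw [← div_eq_mul_inv, le_div_iff₀ (by positivity)]
  linarith

theorem exists_norm_schwartz_sub_le {E : Type*} [NormedAddCommGroup E] [NormedSpace ℝ E]
    (φ : 𝓢(ℝ, E)) :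
    ∃ C, ∀ x y : ℝ, y ≤ x → x - y ≤ 1 → ‖φ y - φ x‖ ≤ (x - y) * (C * (1 + x ^ 2)⁻¹) := by
  obtain ⟨C, hC⟩ := exists_norm_deriv_schwartz_le φ
  have hC_nonneg : 0 ≤ C := by simpa using (norm_nonneg _).trans (hC 0)
  refine ⟨C * 3, fun x y hyx hxy => ?_⟩
  have hderiv (z : ℝ) (hz : z ∈ Set.Icc y x) : ‖deriv φ z‖ ≤ C * 3 * (1 + x ^ 2)⁻¹ := by
    have hweight : 1 + x ^ 2 ≤ 3 * (1 + z ^ 2) := by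
      have hxz : (x - z) ^ 2 ≤ 1 := by
        rw [sq_le_one_iff₀ (sub_nonneg.2 hz.2)]
        linarith [hz.1]
      nlinarith [sq_nonneg (2 * z - x)]
    refine (hC z).trans ?_
    rw [mul_assoc]
    gcongr
    rw [← div_eq_mul_inv, inv_eq_one_div, div_le_div_iff₀ (by positivity) (by positivity)]
    linarith
  have hmean := Convex.norm_image_sub_le_of_norm_deriv_le (𝕜 := ℝ)
    (fun z _ => φ.differentiable.differentiableAt) hderiv (convex_Icc y x)
    (Set.right_mem_Icc.2 hyx) (Set.left_mem_Icc.2 hyx)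
  rwa [Real.norm_eq_abs, abs_sub_comm, abs_of_nonneg (sub_nonneg.2 hyx), mul_comm] at hmean

theorem memLp_inv_one_add_sq : MemLp (fun x : ℝ => (1 + x ^ 2)⁻¹) 2 volume := by
  have hcont : Continuous fun x : ℝ => (1 + x ^ 2)⁻¹ :=
    Continuous.inv₀ (by fun_prop) fun x => by positivity
  rw [memLp_two_iff_integrable_sq_norm hcont.aestronglyMeasurable]
  refine integrable_inv_one_add_sq.mono' (by fun_prop) (Eventually.of_forall fun x => ?_)
  have hle : (1 + x ^ 2)⁻¹ ≤ 1 := inv_le_one_of_one_le₀ (le_add_of_nonneg_right (sq_nonneg x))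
  rw [norm_pow, norm_norm, Real.norm_of_nonneg (by positivity), sq]
  exact mul_le_of_le_one_left (by positivity) hle

theorem exists_eventually_norm_sample_sub_le {f : L2} (hf : f ∈ bandLimited) :
    ∃ C, ∀ᶠ δ in 𝓝[>] 0, ‖sample δ f - f‖ ≤ δ * C := by
  obtain ⟨ψ, hsupport, hψ⟩ := hf
  have hfψ : f = (𝓕⁻ ψ).toLp 2 := by
    rw [← SchwartzMap.toLp_fourierInv_eq, ← hψ, FourierTransform.fourierInv_fourier_eq]
  have hf_ae : f =ᵐ[volume] (𝓕⁻ ψ : 𝓢(ℝ, Spinor)) := by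
    rw [hfψ]
    exact (𝓕⁻ ψ).coeFn_toLp 2 volume
  obtain ⟨C, hC⟩ := exists_norm_schwartz_sub_le (𝓕⁻ ψ)
  have hmem := memLp_inv_one_add_sq.const_mul C
  refine ⟨‖hmem.toLp‖, ?_⟩
  filter_upwards [eventually_support_subset_band hsupport, self_mem_nhdsWithin,
    nhdsWithin_le_nhds (gt_mem_nhds one_pos)] with δ hband (hδ : 0 < δ) hδ_lt_one
  refine Lp.norm_le_mul_norm_of_ae_le_mul ?_
  filter_upwards [coeFn_step hδ (summable_norm_sq_shannonInv hδ f), Lp.coeFn_sub (sample δ f) f,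
    hf_ae, hmem.coeFn_toLp] with x hstep hsub hfx hC_ae
  rw [hsub, Pi.sub_apply, sample, hstep, hfx, hC_ae, shannonInv_of_support_subset_band hψ hband,
    mul_comm δ]
  have hfloor_lt := lt_floor_div_add_one_mul hδ x
  rw [add_one_mul] at hfloor_lt
  calc ‖(𝓕⁻ ψ) (⌊x / δ⌋ * δ) - (𝓕⁻ ψ) x‖
      ≤ (x - ⌊x / δ⌋ * δ) * (C * (1 + x ^ 2)⁻¹) := hC x _ (floor_div_mul_le hδ x) (by linarith)
    _ ≤ (x - ⌊x / δ⌋ * δ) * ‖C * (1 + x ^ 2)⁻¹‖ :=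
        mul_le_mul_of_nonneg_left (Real.le_norm_self _) (sub_nonneg.2 (floor_div_mul_le hδ x))
    _ ≤ δ * ‖C * (1 + x ^ 2)⁻¹‖ :=
        mul_le_mul_of_nonneg_right (by linarith) (norm_nonneg _)

theorem tendsto_sample {f : L2} (hf : f ∈ bandLimited) :
    Tendsto (fun δ => sample δ f) (𝓝[>] 0) (𝓝 f) := by
  obtain ⟨C, hC⟩ := exists_eventually_norm_sample_sub_le hf
  rw [tendsto_iff_norm_sub_tendsto_zero]
  refine squeeze_zero' (Eventually.of_forall fun _ => norm_nonneg _) hC ?_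
  exact ((continuous_mul_const C).tendsto' 0 0 (zero_mul C)).mono_left nhdsWithin_le_nhds

theorem eventually_norm_sub_le_of_isCompact {ι E : Type*} [NormedAddCommGroup E] {l : Filter ι}
    {A : ι → E → E} (hA : ∀ᶠ i in l, ∀ f g, ‖A i f - A i g‖ ≤ ‖f - g‖) {S : Set E} (hS : Dense S)
    (hlim : ∀ f ∈ S, Tendsto (fun i => A i f) l (𝓝 f)) {K : Set E} (hK : IsCompact K)
    {ε : ℝ} (hε : 0 < ε) : ∀ᶠ i in l, ∀ f ∈ K, ‖A i f - f‖ ≤ ε := by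
  have hε3 : 0 < ε / 3 := by positivity
  obtain ⟨t, ht⟩ := hK.elim_finite_subcover (fun s : S => Metric.ball (s : E) (ε / 3))
    (fun _ => Metric.isOpen_ball) fun f _ => by
      obtain ⟨s, hs, hdist⟩ := hS.exists_dist_lt f hε3
      exact Set.mem_iUnion.2 ⟨⟨s, hs⟩, hdist⟩
  have hnet : ∀ᶠ i in l, ∀ s ∈ t, ‖A i s - s‖ ≤ ε / 3 := by
    rw [Filter.eventually_all_finset]
    intro s _
    filter_upwards [(hlim s s.2).eventually (Metric.closedBall_mem_nhds _ hε3)] with i h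
    rwa [dist_eq_norm] at h
  filter_upwards [hnet, hA] with i hi hAi f hf
  obtain ⟨s, hs, hfs⟩ := Set.mem_iUnion₂.1 (ht hf)
  rw [mem_ball_iff_norm] at hfs
  calc ‖A i f - f‖ = ‖(A i f - A i s) + (A i s - s) - (f - s)‖ := by congr 1; abel
    _ ≤ ‖A i f - A i s‖ + ‖A i s - s‖ + ‖f - s‖ :=
        (norm_sub_le _ _).trans (by gcongr; exact norm_add_le _ _)
    _ ≤ ε := by linarith [hAi f s, hi s hs]

theorem eventually_norm_sample_sub_le {K : Set L2} (hK : IsCompact K) {ε : ℝ} (hε : 0 < ε) :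
    ∀ᶠ δ in 𝓝[>] 0, ∀ f ∈ K, ‖sample δ f - f‖ ≤ ε := by
  refine eventually_norm_sub_le_of_isCompact ?_ dense_bandLimited (fun _ => tendsto_sample) hK hε
  filter_upwards [self_mem_nhdsWithin] with δ hδ f g
  rw [← sample_sub hδ]
  exact norm_sample_le hδ _

theorem eventually_norm_bandProj_sub_le {K : Set L2} (hK : IsCompact K) {ε : ℝ} (hε : 0 < ε) :
    ∀ᶠ δ in 𝓝[>] 0, ∀ f ∈ K, ‖bandProj δ f - f‖ ≤ ε := by
  refine eventually_norm_sub_le_of_isCompact ?_ dense_bandLimited (fun _ => tendsto_bandProj) hK hε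
  filter_upwards with δ f g
  rw [← bandProj_sub]
  exact norm_bandProj_le δ _

theorem ae_norm_le_of_tendsto {α ι E : Type*} [MeasurableSpace α] {μ : Measure α}
    [NormedAddCommGroup E] {p : ENNReal} [Fact (1 ≤ p)] {l : Filter ι} [l.NeBot]
    [l.IsCountablyGenerated] {F : ι → Lp E p μ} {f : Lp E p μ} (hF : Tendsto F l (𝓝 f)) {R : ℝ}
    (hR : ∀ᶠ i in l, ∀ᵐ x ∂μ, ‖F i x‖ ≤ R) : ∀ᵐ x ∂μ, ‖f x‖ ≤ R := by
  obtain ⟨u, hu⟩ := l.exists_seq_tendsto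
  obtain ⟨N, hN⟩ := eventually_atTop.1 (hu.eventually hR)
  obtain ⟨k, hk, hae⟩ := (tendstoInMeasure_of_tendsto_Lp (hF.comp hu)).exists_seq_tendsto_ae
  have hbound : ∀ᵐ x ∂μ, ∀ n, N ≤ n → ‖F (u n) x‖ ≤ R := by
    simpa only [ae_all_iff] using hN
  filter_upwards [hae, hbound] with x hx hbound_x
  refine le_of_tendsto hx.norm ?_
  filter_upwards [hk.tendsto_atTop.eventually_ge_atTop N] with n hn
  exact hbound_x _ hn

theorem IsWeakDeriv.ae_norm_le {f g : L2} (h : IsWeakDeriv 1 f g) :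
    ∀ᵐ x, ‖f x‖ ≤ ‖f‖ + 1 + ‖g‖ := by
  have hlim : Tendsto (fun δ => sample δ f) (𝓝[>] 0) (𝓝 f) := by
    rw [Metric.nhds_basis_closedBall.tendsto_right_iff]
    intro ε hε
    filter_upwards [eventually_norm_sample_sub_le (isCompact_singleton (x := f)) hε] with δ hδ
    exact mem_closedBall_iff_norm.2 (hδ f rfl)
  refine ae_norm_le_of_tendsto hlim ?_
  filter_upwards [self_mem_nhdsWithin] with δ (hδ : 0 < δ)
  have hzero : ∀ᵐ x, ‖(0 : L2) x‖ ≤ 0 := by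
    filter_upwards [Lp.coeFn_zero Spinor 2 (volume : Measure ℝ)] with x hx
    rw [hx, Pi.zero_apply, norm_zero]
  have hnear : ‖step δ (shannonInv δ f) - 0‖ < (‖f‖ + 1) * √1 := by
    rw [sub_zero, Real.sqrt_one, mul_one]
    exact (norm_sample_le hδ f).trans_lt (lt_add_one _)
  have hsum := summable_norm_sq_shannonInv hδ f
  filter_upwards [coeFn_step hδ hsum] with x hx
  rw [sample, hx]
  simpa using norm_apply_le_of_norm_step_sub_lt hδ hsum (by positivity) one_pos
    (h.norm_translate_sample_sub_le hδ) hzero hnear ⌊x / δ⌋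

end Samples

/-! ### Superposition operators and the local step on `L²` -/

section Superposition

variable {α E : Type*} [MeasurableSpace α] {μ : Measure α} {p : ENNReal} [NormedAddCommGroup E]

open Classical in
/-- The superposition operator `f ↦ φ(·, f(·))` on `Lᵖ`; zero where the result is not in `Lᵖ`. -/
def superposition (φ : α → E → E) (f : Lp E p μ) : Lp E p μ :=
  if h : MemLp (fun x => φ x (f x)) p μ then h.toLp else 0

variable [MeasurableSpace E] [BorelSpace E] [SecondCountableTopology E] {φ : α → E → E} {B : ℝ}

theorem coeFn_superposition (hφ : Measurable (Function.uncurry φ))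
    (hB : ∀ x v, ‖φ x v‖ ≤ B * ‖v‖) (f : Lp E p μ) :
    superposition φ f =ᵐ[μ] fun x => φ x (f x) := by
  have hmem : MemLp (fun x => φ x (f x)) p μ :=
    (Lp.memLp f).of_le_mul
      (hφ.comp_aemeasurable (aemeasurable_id.prodMk
        (Lp.aestronglyMeasurable f).aemeasurable)).aestronglyMeasurable
      (Eventually.of_forall fun x => hB x (f x))
  rw [superposition, dif_pos hmem]
  exact hmem.coeFn_toLp

theorem norm_superposition_sub_le (hφ : Measurable (Function.uncurry φ))
    (hφ_zero : ∀ x, φ x 0 = 0) (hB : ∀ x v w, ‖φ x v - φ x w‖ ≤ B * ‖v - w‖) (f g : Lp E p μ) :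
    ‖superposition φ f - superposition φ g‖ ≤ B * ‖f - g‖ := by
  have hgrowth (x : α) (v : E) : ‖φ x v‖ ≤ B * ‖v‖ := by simpa [hφ_zero] using hB x v 0
  refine Lp.norm_le_mul_norm_of_ae_le_mul ?_
  filter_upwards [coeFn_superposition hφ hgrowth f, coeFn_superposition hφ hgrowth g,
    Lp.coeFn_sub (superposition φ f) (superposition φ g), Lp.coeFn_sub f g] with x h1 h2 h3 h4
  rw [h3, h4, Pi.sub_apply, Pi.sub_apply, h1, h2]
  exact hB x _ _

end Superposition

section LocalStep

variable {E : Type*} [NormedAddCommGroup E] [InnerProductSpace ℂ E] [CompleteSpace E]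
  {A : ℝ → E →L[ℂ] E} {Γ : E →L[ℂ] E} {G : E → ℝ} {K C δ : ℝ}

/-- A bounded Lipschitz family of self-adjoint operators. -/
structure IsTameField (A : ℝ → E →L[ℂ] E) (C : ℝ) : Prop where
  isSelfAdjoint : ∀ x, IsSelfAdjoint (A x)
  bound : ∀ x, ‖A x‖ ≤ C
  lipschitz : ∀ x y, ‖A x - A y‖ ≤ C * |x - y|

theorem IsTameField.nonneg (hA : IsTameField A C) : 0 ≤ C := (norm_nonneg _).trans (hA.bound 0)

theorem IsTameField.continuous (hA : IsTameField A C) : Continuous A := by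
  refine (LipschitzWith.of_dist_le_mul (K := C.toNNReal) fun x y => ?_).continuous
  rw [dist_eq_norm, Real.dist_eq, Real.coe_toNNReal _ hA.nonneg]
  exact hA.lipschitz x y

theorem IsTameField.norm_potential_sub_le (hA : IsTameField A C) (Γ : E →L[ℂ] E)
    (hG : IsTame G K) (x : ℝ) (v w : E) :
    ‖potential (A x) Γ G v - potential (A x) Γ G w‖ ≤ (C + 2 * (K * ‖Γ‖)) * ‖v - w‖ :=
  (NLQW.norm_potential_sub_le (A x) Γ hG v w).trans (by gcongr; exact hA.bound x)

theorem IsTameField.norm_potential_le (hA : IsTameField A C) (Γ : E →L[ℂ] E)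
    (hG : IsTame G K) (x : ℝ) (v : E) :
    ‖potential (A x) Γ G v‖ ≤ (C + 2 * (K * ‖Γ‖)) * ‖v‖ := by
  simpa only [potential_zero, sub_zero] using hA.norm_potential_sub_le Γ hG x v 0

theorem IsTameField.continuous_potential (hA : IsTameField A C) (Γ : E →L[ℂ] E)
    (hG : IsTame G K) : Continuous fun q : ℝ × E => potential (A q.1) Γ G q.2 := by
  refine continuous_prod_of_continuous_lipschitzWith' _ (C + 2 * (K * ‖Γ‖)).toNNReal
    (fun x => LipschitzWith.of_dist_le_mul fun v w => ?_) fun v =>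
      (hA.continuous.clm_apply continuous_const).add (continuous_const (y := (G v : ℂ) • Γ v))
  have := hG.nonneg
  have := hA.nonneg
  rw [dist_eq_norm, dist_eq_norm, Real.coe_toNNReal _ (by positivity)]
  exact hA.norm_potential_sub_le Γ hG x v w

theorem IsTameField.continuous_splitStep (hA : IsTameField A C) (hΓ : IsSelfAdjoint Γ)
    (hG : IsTame G K) (hδ : 0 ≤ δ) :
    Continuous fun q : ℝ × E => splitStep (A q.1) Γ G δ q.2 := by
  let _ : NormedAlgebra ℚ (E →L[ℂ] E) := NormedAlgebra.restrictScalars ℚ ℂ _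
  refine continuous_prod_of_continuous_lipschitzWith' _ (1 + δ * (K * ‖Γ‖)).toNNReal
    (fun x => LipschitzWith.of_dist_le_mul fun v w => ?_) fun v =>
      (NormedSpace.exp_continuous.comp
        (hA.continuous.const_smul (-(Complex.I * (δ : ℂ))))).clm_apply
          (continuous_const (y := unitaryGroup Γ (δ * G v) v))
  have := hG.nonneg
  rw [dist_eq_norm, dist_eq_norm, Real.coe_toNNReal _ (by positivity)]
  exact norm_splitStep_sub_le (hA.isSelfAdjoint x) hΓ hG hδ v w

/-- The step of the walk before the shift, as a function on the line: on each cell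
`[δ n, δ (n + 1))` it is the splitting step at the lattice point `δ n`. -/
def localStep (A : ℝ → E →L[ℂ] E) (Γ : E →L[ℂ] E) (G : E → ℝ) (δ x : ℝ) (v : E) : E :=
  splitStep (A (δ * ⌊x / δ⌋)) Γ G δ v

theorem norm_localStep_sub_euler_le (hA : IsTameField A C) (hΓ : IsSelfAdjoint Γ)
    (hG : IsTame G K) (hδ : 0 < δ) (x : ℝ) (v : E) :
    ‖localStep A Γ G δ x v - (v - (δ * Complex.I : ℂ) • potential (A x) Γ G v)‖
      ≤ δ ^ 2 * ((C + K * ‖Γ‖) ^ 2 + C) * ‖v‖ := by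
  let y := δ * ⌊x / δ⌋
  have hA_nonneg := hA.nonneg
  have hG_nonneg := hG.nonneg
  have hyx : |y - x| ≤ δ := by
    have hle := floor_div_mul_le hδ x
    have hlt := lt_floor_div_add_one_mul hδ x
    rw [abs_le]
    constructor <;> linarith
  have hpotential : ‖(δ * Complex.I : ℂ) • (potential (A y) Γ G v - potential (A x) Γ G v)‖
      ≤ δ * (C * δ * ‖v‖) := by
    rw [potential_sub_potential, norm_smul, norm_mul, Complex.norm_I, mul_one, Complex.norm_real,
      Real.norm_of_nonneg hδ.le]
    gcongr
    exact ContinuousLinearMap.le_of_opNorm_le _ ((hA.lipschitz y x).trans (by gcongr)) v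
  have heuler : ‖splitStep (A y) Γ G δ v - (v - (δ * Complex.I : ℂ) • potential (A y) Γ G v)‖
      ≤ (δ * (C + K * ‖Γ‖)) ^ 2 * ‖v‖ :=
    (norm_splitStep_sub_euler_le (hA.isSelfAdjoint y) hΓ hG hδ.le v).trans
      (by gcongr; exact hA.bound y)
  calc ‖localStep A Γ G δ x v - (v - (δ * Complex.I : ℂ) • potential (A x) Γ G v)‖
      = ‖(splitStep (A y) Γ G δ v - (v - (δ * Complex.I : ℂ) • potential (A y) Γ G v))
          - (δ * Complex.I : ℂ) • (potential (A y) Γ G v - potential (A x) Γ G v)‖ := by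
        rw [smul_sub, localStep]
        congr 1
        abel
    _ ≤ (δ * (C + K * ‖Γ‖)) ^ 2 * ‖v‖ + δ * (C * δ * ‖v‖) :=
        (norm_sub_le _ _).trans (add_le_add heuler hpotential)
    _ = δ ^ 2 * ((C + K * ‖Γ‖) ^ 2 + C) * ‖v‖ := by ring

theorem norm_localStep_sub_le (hA : IsTameField A C) (hΓ : IsSelfAdjoint Γ) (hG : IsTame G K)
    (hδ : 0 ≤ δ) (x : ℝ) (v w : E) :
    ‖localStep A Γ G δ x v - localStep A Γ G δ x w‖ ≤ (1 + δ * (K * ‖Γ‖)) * ‖v - w‖ :=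
  norm_splitStep_sub_le (hA.isSelfAdjoint _) hΓ hG hδ v w

theorem norm_localStep (hA : IsTameField A C) (hΓ : IsSelfAdjoint Γ) (G : E → ℝ) (δ x : ℝ)
    (v : E) : ‖localStep A Γ G δ x v‖ = ‖v‖ :=
  norm_splitStep (hA.isSelfAdjoint _) hΓ G δ v

theorem norm_localStep_sub_localStep_le (hA : IsTameField A C) (hΓ : IsSelfAdjoint Γ) (G : E → ℝ)
    (hδ : 0 < δ) (x : ℝ) (v : E) :
    ‖localStep A Γ G δ (x - δ) v - localStep A Γ G δ x v‖ ≤ C * δ ^ 2 * ‖v‖ := by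
  refine (norm_splitStep_sub_splitStep_le (hA.isSelfAdjoint _) (hA.isSelfAdjoint _) hΓ G hδ.le
    v).trans ?_
  have hdist : |δ * (⌊(x - δ) / δ⌋ : ℝ) - δ * ⌊x / δ⌋| = δ := by
    rw [floor_sub_div hδ, Int.cast_sub, Int.cast_one, mul_sub, mul_one, sub_sub_cancel_left,
      abs_neg, abs_of_pos hδ]
  calc δ * ‖A (δ * ⌊(x - δ) / δ⌋) - A (δ * ⌊x / δ⌋)‖ * ‖v‖ ≤ δ * (C * δ) * ‖v‖ := by
        gcongr
        exact (hA.lipschitz _ _).trans_eq (by rw [hdist])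
    _ = C * δ ^ 2 * ‖v‖ := by ring

variable [MeasurableSpace E] [BorelSpace E] [SecondCountableTopology E]

theorem measurable_localStep (hA : IsTameField A C) (hΓ : IsSelfAdjoint Γ) (hG : IsTame G K)
    (hδ : 0 ≤ δ) : Measurable (Function.uncurry (localStep A Γ G δ)) := by
  have hfloor : Measurable fun x : ℝ => δ * (⌊x / δ⌋ : ℝ) :=
    ((measurable_of_countable fun n : ℤ => (n : ℝ)).comp (measurable_floor_div δ)).const_mul δ
  exact (hA.continuous_splitStep hΓ hG hδ).measurable.comp
    ((hfloor.comp measurable_fst).prodMk measurable_snd)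

theorem coeFn_superposition_localStep (hA : IsTameField A C) (hΓ : IsSelfAdjoint Γ)
    (hG : IsTame G K) (hδ : 0 ≤ δ) (f : Lp E 2 (volume : Measure ℝ)) :
    superposition (localStep A Γ G δ) f =ᵐ[volume] fun x => localStep A Γ G δ x (f x) :=
  coeFn_superposition (measurable_localStep hA hΓ hG hδ)
    (fun x v => ((norm_localStep hA hΓ G δ x v).trans (one_mul ‖v‖).symm).le) f

theorem norm_superposition_localStep_sub_le (hA : IsTameField A C) (hΓ : IsSelfAdjoint Γ)
    (hG : IsTame G K) (hδ : 0 ≤ δ) (f g : Lp E 2 (volume : Measure ℝ)) :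
    ‖superposition (localStep A Γ G δ) f - superposition (localStep A Γ G δ) g‖
      ≤ (1 + δ * (K * ‖Γ‖)) * ‖f - g‖ :=
  norm_superposition_sub_le (measurable_localStep hA hΓ hG hδ)
    (fun x => norm_eq_zero.1 ((norm_localStep hA hΓ G δ x 0).trans norm_zero))
    (norm_localStep_sub_le hA hΓ hG hδ) f g

theorem norm_translate_superposition_localStep_sub_le (hA : IsTameField A C)
    (hΓ : IsSelfAdjoint Γ) (hG : IsTame G K) (hδ : 0 < δ) (f : Lp E 2 (volume : Measure ℝ)) :
    ‖translate δ (superposition (localStep A Γ G δ) f) - superposition (localStep A Γ G δ) f‖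
      ≤ (1 + δ * (K * ‖Γ‖)) * ‖translate δ f - f‖ + C * δ ^ 2 * ‖f‖ := by
  have hA_nonneg := hA.nonneg
  have hG_nonneg := hG.nonneg
  have hstep := coeFn_superposition_localStep hA hΓ hG hδ.le f
  refine norm_le_add_mul_of_ae_le (by positivity) (by positivity) ?_
  filter_upwards [hstep, ae_comp_sub hstep δ, coeFn_translate δ f,
    coeFn_translate δ (superposition (localStep A Γ G δ) f), Lp.coeFn_sub (translate δ f) f,
    Lp.coeFn_sub (translate δ (superposition (localStep A Γ G δ) f))
      (superposition (localStep A Γ G δ) f)] with x h1 h2 h3 h4 h5 h6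
  rw [h5, h6, Pi.sub_apply, Pi.sub_apply, h4, h3, h2, h1]
  exact (norm_sub_le_norm_sub_add_norm_sub _ (localStep A Γ G δ (x - δ) (f x)) _).trans
    (add_le_add (norm_localStep_sub_le hA hΓ hG hδ.le _ _ _)
      (norm_localStep_sub_localStep_le hA hΓ G hδ x (f x)))

theorem coeFn_superposition_potential (hA : IsTameField A C) (Γ : E →L[ℂ] E) (hG : IsTame G K)
    (f : Lp E 2 (volume : Measure ℝ)) :
    superposition (fun x => potential (A x) Γ G) f
      =ᵐ[volume] fun x => potential (A x) Γ G (f x) :=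
  coeFn_superposition (hA.continuous_potential Γ hG).measurable (hA.norm_potential_le Γ hG) f

theorem continuous_superposition_potential (hA : IsTameField A C) (Γ : E →L[ℂ] E)
    (hG : IsTame G K) : Continuous fun f : Lp E 2 (volume : Measure ℝ) =>
      superposition (fun x => potential (A x) Γ G) f := by
  refine (LipschitzWith.of_dist_le_mul (K := (C + 2 * (K * ‖Γ‖)).toNNReal)
    fun f g => ?_).continuous
  have := hG.nonneg
  have := hA.nonneg
  rw [dist_eq_norm, dist_eq_norm, Real.coe_toNNReal _ (by positivity)]
  exact norm_superposition_sub_le (hA.continuous_potential Γ hG).measurable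
    (fun x => potential_zero (A x) Γ G) (hA.norm_potential_sub_le Γ hG) f g

theorem norm_superposition_localStep_sub_euler_le (hA : IsTameField A C) (hΓ : IsSelfAdjoint Γ)
    (hG : IsTame G K) (hδ : 0 < δ) (f : Lp E 2 (volume : Measure ℝ)) :
    ‖superposition (localStep A Γ G δ) f
        - (f - (δ * Complex.I : ℂ) • superposition (fun x => potential (A x) Γ G) f)‖
      ≤ δ ^ 2 * ((C + K * ‖Γ‖) ^ 2 + C) * ‖f‖ := by
  refine Lp.norm_le_mul_norm_of_ae_le_mul ?_
  let P := superposition (fun x => potential (A x) Γ G) f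
  filter_upwards [coeFn_superposition_localStep hA hΓ hG hδ.le f,
    coeFn_superposition_potential hA Γ hG f, Lp.coeFn_smul (δ * Complex.I : ℂ) P,
    Lp.coeFn_sub (superposition (localStep A Γ G δ) f) (f - (δ * Complex.I : ℂ) • P),
    Lp.coeFn_sub f ((δ * Complex.I : ℂ) • P)] with x h1 h2 h3 h4 h5
  rw [h4, Pi.sub_apply, h5, Pi.sub_apply, h3, Pi.smul_apply, h1, h2]
  exact norm_localStep_sub_euler_le hA hΓ hG hδ x (f x)

end LocalStep

/-! ### Duhamel's formula to first order -/

theorem hasDerivWithinAt_transport_neg {u : ℝ → L2} {v u' : L2} {s : Set ℝ} {r : ℝ}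
    (hu : HasDerivWithinAt u v s r) (hu' : IsWeakDeriv 1 (u r) u') :
    HasDerivWithinAt (fun q => transport (-q) (u q)) (transport (-r) (v + sigmaThree u')) s r := by
  have hfrozen := (hu'.hasDerivAt_transport_neg r).hasDerivWithinAt (s := s)
  have hincrement :
      HasDerivWithinAt (fun q => transport (-q) (u q - u r)) (transport (-r) v) s r := by
    rw [hasDerivWithinAt_iff_tendsto_slope] at hu ⊢
    have hneg : Tendsto (fun q : ℝ => -q) (𝓝[s \ {r}] r) (𝓝 (-r)) :=
      (continuous_neg.tendsto r).mono_left nhdsWithin_le_nhds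
    refine ((continuous_transport.tendsto (-r, v)).comp (hneg.prodMk_nhds hu)).congr fun q => ?_
    simp only [Function.comp_apply, slope, vsub_eq_sub, sub_self, map_zero, sub_zero]
    exact map_real_smul (transport (-q)) (map_continuous _) _ _
  rw [map_add]
  refine (hincrement.add hfrozen).congr (fun q _ => ?_) ?_ <;> simp

section Duhamel

variable {T : ℝ} {u p u' : ℝ → L2}

/-- In the interaction picture the differential operator disappears from the equation. -/
theorem hasDerivWithinAt_transport_neg_add (hu' : ∀ t ∈ Set.Icc 0 T, IsWeakDeriv 1 (u t) (u' t))
    (hu : ∀ t ∈ Set.Icc 0 T,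
      HasDerivWithinAt u (-sigmaThree (u' t) - Complex.I • p t) (Set.Icc 0 T) t)
    {t δ : ℝ} (ht : 0 ≤ t) (htδ : t + δ ≤ T) {r : ℝ} (hr : r ∈ Set.Icc 0 δ) :
    HasDerivWithinAt (fun r => transport (-r) (u (t + r)))
      (-(Complex.I • transport (-r) (p (t + r)))) (Set.Icc 0 δ) r := by
  have hmaps : Set.MapsTo (t + ·) (Set.Icc 0 δ) (Set.Icc 0 T) := fun q hq =>
    ⟨add_nonneg ht hq.1, by linarith [hq.2]⟩
  have hshift : HasDerivWithinAt (fun r => u (t + r))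
      (-sigmaThree (u' (t + r)) - Complex.I • p (t + r)) (Set.Icc 0 δ) r :=
    ((hu (t + r) (hmaps hr)).scomp r
      ((hasDerivAt_id r).const_add t).hasDerivWithinAt hmaps).congr_deriv (one_smul ℝ _)
  refine (hasDerivWithinAt_transport_neg hshift (hu' (t + r) (hmaps hr))).congr_deriv ?_
  rw [sub_add_eq_add_sub, neg_add_cancel, zero_sub, map_neg, map_smul]

theorem eventually_norm_transport_neg_sub_le (hp : ContinuousOn p (Set.Icc 0 T)) {ε : ℝ}
    (hε : 0 < ε) : ∀ᶠ δ : ℝ in 𝓝[>] 0, ∀ t, 0 ≤ t → t + δ ≤ T → ∀ r ∈ Set.Icc 0 δ,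
      ‖transport (-r) (p (t + r)) - p t‖ ≤ ε := by
  have hcont : ContinuousOn (fun q : ℝ × ℝ => transport (-q.1) (p q.2))
      (Set.Icc 0 1 ×ˢ Set.Icc 0 T) :=
    continuous_transport.comp_continuousOn (f := fun q : ℝ × ℝ => (-q.1, p q.2))
      (continuous_fst.neg.continuousOn.prodMk
        (hp.comp continuous_snd.continuousOn fun _ hq => hq.2))
  obtain ⟨η, hη, hunif⟩ := Metric.uniformContinuousOn_iff.1
    ((isCompact_Icc.prod isCompact_Icc).uniformContinuousOn_of_continuous hcont) ε hε
  filter_upwards [nhdsWithin_le_nhds (gt_mem_nhds hη), nhdsWithin_le_nhds (gt_mem_nhds one_pos)]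
    with δ hδη hδ_lt_one t ht htδ r ⟨hr, hrδ⟩
  have hdist : dist (r, t + r) (0, t) < η := by
    rw [Prod.dist_eq, Real.dist_eq, Real.dist_eq, sub_zero, add_sub_cancel_left, max_self,
      abs_of_nonneg hr]
    linarith
  have hclose := hunif (r, t + r) ⟨⟨hr, by linarith⟩, by linarith, by linarith⟩ (0, t)
    ⟨⟨le_rfl, zero_le_one⟩, ht, by linarith⟩ hdist
  rw [dist_eq_norm, neg_zero, transport_zero] at hclose
  exact hclose.le

theorem eventually_norm_transport_neg_sub_euler_le (hp : ContinuousOn p (Set.Icc 0 T))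
    (hu' : ∀ t ∈ Set.Icc 0 T, IsWeakDeriv 1 (u t) (u' t))
    (hu : ∀ t ∈ Set.Icc 0 T,
      HasDerivWithinAt u (-sigmaThree (u' t) - Complex.I • p t) (Set.Icc 0 T) t)
    {ε : ℝ} (hε : 0 < ε) : ∀ᶠ δ : ℝ in 𝓝[>] 0, ∀ t, 0 ≤ t → t + δ ≤ T →
      ‖transport (-δ) (u (t + δ)) - (u t - (δ * Complex.I : ℂ) • p t)‖ ≤ ε * δ := by
  filter_upwards [self_mem_nhdsWithin, eventually_norm_transport_neg_sub_le hp hε]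
    with δ (hδ : 0 < δ) hclose t ht htδ
  have hderiv (r : ℝ) (hr : r ∈ Set.Icc 0 δ) :=
    (hasDerivWithinAt_transport_neg_add hu' hu ht htδ hr).add
      ((hasDerivAt_id r).smul_const (Complex.I • p t)).hasDerivWithinAt
  have hmean := norm_image_sub_le_of_norm_deriv_le_segment' hderiv
    (fun r hr => by
      rw [one_smul, neg_add_eq_sub, ← smul_sub, norm_smul, Complex.norm_I, one_mul, norm_sub_rev]
      exact hclose t ht htδ r (Set.Ico_subset_Icc_self hr)) δ (Set.right_mem_Icc.2 hδ.le)
  refine (congrArg norm ?_).trans_le (hmean.trans_eq (by rw [sub_zero]))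
  simp only [Pi.add_apply, id_eq, neg_zero, transport_zero, add_zero, zero_smul, mul_smul,
    Complex.coe_smul]
  abel

end Duhamel

/-! ### The discrete Gronwall inequality -/

theorem le_exp_mul_of_succ_le {e : ℕ → ℝ} {B δ c : ℝ} (hB : 0 ≤ B) (hδ : 0 ≤ δ) (hc : 0 ≤ c)
    (he : 0 ≤ e 0) {N : ℕ} (hsucc : ∀ m < N, e (m + 1) ≤ (1 + B * δ) * e m + δ * c) :
    ∀ m ≤ N, e m ≤ Real.exp (B * (δ * m)) * (e 0 + δ * m * c) := by
  intro m
  induction m with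
  | zero => simp
  | succ m ih =>
    intro hm
    have hexp : 1 + B * δ ≤ Real.exp (B * δ) := (add_comm _ _).trans_le (Real.add_one_le_exp _)
    have hone : 1 ≤ Real.exp (B * (δ * (m + 1 : ℕ))) := Real.one_le_exp (by positivity)
    have hih := ih (by omega)
    calc e (m + 1) ≤ (1 + B * δ) * e m + δ * c := hsucc m (by omega)
      _ ≤ (1 + B * δ) * (Real.exp (B * (δ * m)) * (e 0 + δ * m * c)) + δ * c := by gcongr
      _ ≤ Real.exp (B * δ) * (Real.exp (B * (δ * m)) * (e 0 + δ * m * c)) + δ * c := by gcongr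
      _ = Real.exp (B * (δ * (m + 1 : ℕ))) * (e 0 + δ * m * c) + 1 * (δ * c) := by
          rw [← mul_assoc, ← Real.exp_add]
          push_cast
          ring_nf
      _ ≤ Real.exp (B * (δ * (m + 1 : ℕ))) * (e 0 + δ * m * c)
          + Real.exp (B * (δ * (m + 1 : ℕ))) * (δ * c) := by gcongr
      _ = Real.exp (B * (δ * (m + 1 : ℕ))) * (e 0 + δ * (m + 1 : ℕ) * c) := by
          push_cast
          ring

/-! ### Coefficients -/

section Coefficients

variable {E : Type*} [NormedAddCommGroup E]

theorem setIntegral_Icc_norm_le {b : ℝ → E} (hb : MemLp b 2 volume) (x : ℝ) :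
    ∫ y in Set.Icc x (x + 1), ‖b y‖ ≤ (eLpNorm b 2 volume).toReal := by
  have : IsProbabilityMeasure (volume.restrict (Set.Icc x (x + 1))) :=
    ⟨by rw [Measure.restrict_apply_univ, Real.volume_Icc, add_sub_cancel_left, ENNReal.ofReal_one]⟩
  have hb_restrict := hb.restrict (Set.Icc x (x + 1))
  rw [integral_norm_eq_lintegral_enorm hb_restrict.1, ← eLpNorm_one_eq_lintegral_enorm]
  exact ENNReal.toReal_mono hb.2.ne
    ((eLpNorm_le_eLpNorm_of_exponent_le one_le_two hb_restrict.1).trans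
      (eLpNorm_mono_measure _ Measure.restrict_le_self))

variable [NormedSpace ℝ E] [CompleteSpace E]

theorem norm_le_of_memLp_deriv {b : ℝ → E} (hb : ContDiff ℝ 1 b) (hb_mem : MemLp b 2 volume)
    (hb_deriv : MemLp (deriv b) 2 volume) (x : ℝ) :
    ‖b x‖ ≤ (eLpNorm b 2 volume).toReal + (eLpNorm (deriv b) 2 volume).toReal := by
  let D := (eLpNorm (deriv b) 2 volume).toReal
  have hcont : Continuous (deriv b) := hb.continuous_deriv le_rfl
  have hnear (y : ℝ) (hy : y ∈ Set.Icc x (x + 1)) : ‖b x‖ - D ≤ ‖b y‖ := by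
    have hftc : ∫ z in x..y, deriv b z = b y - b x :=
      intervalIntegral.integral_deriv_eq_sub (fun z _ => hb.differentiable one_ne_zero z)
        (hcont.intervalIntegrable _ _)
    have hdiff : ‖b x - b y‖ ≤ D := by
      rw [norm_sub_rev, ← hftc]
      refine (intervalIntegral.norm_integral_le_integral_norm hy.1).trans
        (le_trans ?_ (setIntegral_Icc_norm_le hb_deriv x))
      rw [intervalIntegral.integral_of_le hy.1, ← integral_Icc_eq_integral_Ioc]
      exact setIntegral_mono_set hcont.norm.integrableOn_Icc
        (Eventually.of_forall fun _ => norm_nonneg _)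
        (Set.Icc_subset_Icc_right hy.2).eventuallyLE
    linarith [norm_sub_norm_le (b x) (b y)]
  have hmean : ‖b x‖ - D ≤ ∫ y in Set.Icc x (x + 1), ‖b y‖ := by
    simpa using setIntegral_mono_on (μ := volume) (f := fun _ => ‖b x‖ - D)
      continuous_const.integrableOn_Icc hb.continuous.norm.integrableOn_Icc measurableSet_Icc hnear
  linarith [setIntegral_Icc_norm_le hb_mem x]

theorem exists_lipschitzWith_of_memLp_deriv {a : ℝ → E} (ha : ContDiff ℝ 2 a)
    (ha_deriv : MemLp (deriv a) 2 volume) (ha_deriv₂ : MemLp (deriv (deriv a)) 2 volume) :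
    ∃ C, LipschitzWith C a := by
  rw [← one_add_one_eq_two] at ha
  have hbound := norm_le_of_memLp_deriv ha.deriv' ha_deriv ha_deriv₂
  exact ⟨_, lipschitzWith_of_nnnorm_deriv_le (C := (_ : ℝ).toNNReal)
    (ha.differentiable (by simp)) fun x => NNReal.le_toNNReal_of_coe_le (hbound x)⟩

end Coefficients

/-- A matrix as a bounded operator on `ℂ²`. -/
abbrev op (M : Mat2) : Spinor →L[ℂ] Spinor := Matrix.toEuclideanCLM (𝕜 := ℂ) M

theorem isSelfAdjoint_op {M : Mat2} (hM : M.IsHermitian) : IsSelfAdjoint (op M) :=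
  IsSelfAdjoint.map hM.isSelfAdjoint (Matrix.toEuclideanCLM (n := Fin 2) (𝕜 := ℂ))

theorem op_exp (M : Mat2) : op (NormedSpace.exp M) = NormedSpace.exp (op M) := by
  let _ : NormedRing Mat2 := Matrix.linftyOpNormedRing
  let _ : NormedAlgebra ℂ Mat2 := Matrix.linftyOpNormedAlgebra
  let _ : NormedAlgebra ℚ Mat2 := NormedAlgebra.restrictScalars ℚ ℂ Mat2
  let Φ := Matrix.toEuclideanCLM (n := Fin 2) (𝕜 := ℂ)
  exact NormedSpace.map_exp Φ Φ.toAlgEquiv.toLinearMap.continuous_of_finiteDimensional M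

theorem act_exp (M : Mat2) (t : ℝ) (v : Spinor) :
    act (NormedSpace.exp (-(Complex.I * (t : ℂ)) • M)) v = unitaryGroup (op M) t v := by
  rw [unitaryGroup, op, ← map_smul, ← op_exp]
  rfl

theorem pauli_isHermitian (α : Fin 4) : (pauli α).IsHermitian := by
  fin_cases α <;> ext i j <;> fin_cases i <;> fin_cases j <;> simp [pauli]

theorem pauliDot_isHermitian (c : Coeff) : (pauliDot c).IsHermitian := by
  rw [pauliDot, Matrix.IsHermitian, Matrix.conjTranspose_sum]
  refine Finset.sum_congr rfl fun α _ => ?_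
  rw [Matrix.conjTranspose_smul, (pauli_isHermitian α).eq, RCLike.star_def, Complex.conj_ofReal]

theorem pauliDot_sub (c d : Coeff) : pauliDot (c - d) = pauliDot c - pauliDot d := by
  simp [pauliDot, sub_smul, Finset.sum_sub_distrib]

theorem norm_op_pauliDot_le (c : Coeff) : ‖op (pauliDot c)‖ ≤ (∑ α, ‖op (pauli α)‖) * ‖c‖ := by
  rw [pauliDot, op, map_sum, Finset.sum_mul]
  refine (norm_sum_le _ _).trans (Finset.sum_le_sum fun α _ => ?_)
  rw [map_smul, norm_smul, Complex.norm_real, mul_comm]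
  gcongr
  exact PiLp.norm_apply_le c α

theorem exists_isTameField_op_pauliDot {a : ℝ → Coeff} (ha : ∃ M : ℝ, ∀ x, ‖a x‖ ≤ M)
    (ha_lip : ∃ C, LipschitzWith C a) : ∃ C, IsTameField (fun x => op (pauliDot (a x))) C := by
  obtain ⟨M, hM⟩ := ha
  obtain ⟨L, hL⟩ := ha_lip
  let S := ∑ α, ‖op (pauli α)‖
  have : 0 ≤ S := by positivity
  have hM_nonneg : 0 ≤ M := (norm_nonneg _).trans (hM 0)
  refine ⟨S * (M + L), fun x => isSelfAdjoint_op (pauliDot_isHermitian _), fun x => ?_,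
    fun x y => ?_⟩
  · refine (norm_op_pauliDot_le (a x)).trans ?_
    gcongr
    exact (hM x).trans (le_add_of_nonneg_right L.2)
  · rw [op, op, ← map_sub, ← pauliDot_sub]
    calc ‖op (pauliDot (a x - a y))‖ ≤ S * (L * |x - y|) := by
          refine (norm_op_pauliDot_le _).trans ?_
          gcongr
          simpa only [dist_eq_norm, Real.norm_eq_abs] using hL.dist_le_mul x y
      _ ≤ S * (M + L) * |x - y| := by
          rw [← mul_assoc]
          gcongr
          exact le_add_of_nonneg_left hM_nonneg

/-! ### Truncation of the nonlinearity -/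

section Truncation

variable {E : Type*} [NormedAddCommGroup E]

theorem IsTame.of_lipschitzWith {G : E → ℝ} {C : NNReal} {D r : ℝ} (hG : LipschitzWith C G)
    (hr : 0 ≤ r) (hG_bound : ∀ v, |G v| ≤ D) (hG_zero : ∀ v, r ≤ ‖v‖ → G v = 0) :
    IsTame G (C * r + D) := by
  have hD : 0 ≤ D := (abs_nonneg _).trans (hG_bound 0)
  have hlip (v w : E) : |G v - G w| ≤ C * ‖v - w‖ := by
    simpa only [dist_eq_norm, Real.norm_eq_abs] using hG.dist_le_mul v w
  refine ⟨fun v => (hG_bound v).trans (le_add_of_nonneg_left (by positivity)), fun v w => ?_⟩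
  rcases le_total r ‖w‖ with hw | hw
  · rcases le_total r ‖v‖ with hv | hv
    · rw [hG_zero v hv, hG_zero w hw, sub_zero, abs_zero, zero_mul]
      positivity
    · calc |G v - G w| * ‖w‖ ≤ |G v - G w| * (‖v‖ + ‖v - w‖) := by
            gcongr
            exact norm_le_norm_add_norm_sub v w
        _ = |G v - G w| * ‖v‖ + |G v| * ‖v - w‖ := by rw [mul_add, hG_zero w hw, sub_zero]
        _ ≤ C * ‖v - w‖ * r + D * ‖v - w‖ := by
            gcongr
            · exact hlip v w
            · exact hG_bound v
        _ = (C * r + D) * ‖v - w‖ := by ring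
  · calc |G v - G w| * ‖w‖ ≤ C * ‖v - w‖ * r := by
          gcongr
          exact hlip v w
      _ ≤ (C * r + D) * ‖v - w‖ := by
          have : 0 ≤ D * ‖v - w‖ := by positivity
          linarith

theorem exists_isTame_eq_of_norm_le [InnerProductSpace ℝ E] [FiniteDimensional ℝ E] {h : E → ℝ}
    (hh : ContDiff ℝ 1 h) {R : ℝ} (hR : 0 < R) :
    ∃ G K, IsTame G K ∧ ∀ v, ‖v‖ ≤ R → G v = h v := by
  let χ : ContDiffBump (0 : E) := ⟨R, R + 1, hR, lt_add_one R⟩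
  let G (v : E) : ℝ := χ v * h v
  have hG : ContDiff ℝ 1 G := χ.contDiff.mul hh
  have hG_supp : HasCompactSupport G := χ.hasCompactSupport.mul_right
  obtain ⟨C, hC⟩ := hG.lipschitzWith_of_hasCompactSupport hG_supp one_ne_zero
  obtain ⟨D, hD⟩ := hG_supp.exists_bound_of_continuous hG.continuous
  have hG_zero (v : E) (hv : R + 1 ≤ ‖v‖) : G v = 0 :=
    mul_eq_zero_of_left (χ.zero_of_le_dist (by rwa [dist_zero_right])) _
  refine ⟨G, _, .of_lipschitzWith hC (by positivity) hD hG_zero, fun v hv => ?_⟩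
  simp only [G, χ.one_of_mem_closedBall (mem_closedBall_zero_iff.2 hv), one_mul]

end Truncation

theorem contDiff_quadForm (γ : Mat2) : ContDiff ℝ ∞ (quadForm γ) := by
  have hop : ContDiff ℝ ∞ fun v : Spinor => op γ v := ((op γ).restrictScalars ℝ).contDiff
  exact Complex.reCLM.contDiff.comp (hop.inner ℂ contDiff_id)

/-! ### Stability and consistency of the walk -/

section SplitWalk

variable {A : ℝ → Spinor →L[ℂ] Spinor} {Γ : Spinor →L[ℂ] Spinor} {G : Spinor → ℝ} {C K δ : ℝ}
  {w : ℤ → Spinor}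

/-- The quantum walk with an arbitrary linear coin `exp (-i δ A(x))` and nonlinearity `v ↦ G v`, so
that truncating the nonlinearity stays within the class. -/
def splitWalk (A : ℝ → Spinor →L[ℂ] Spinor) (Γ : Spinor →L[ℂ] Spinor) (G : Spinor → ℝ) (δ : ℝ)
    (w : ℤ → Spinor) : ℕ → ℤ → Spinor
  | 0 => w
  | m + 1 => shift fun n => splitStep (A (δ * n)) Γ G δ (splitWalk A Γ G δ w m n)

theorem walk_eq_splitWalk (a : ℝ → Coeff) (γ : Mat2) (g : ℝ → ℝ) (δ : ℝ) (w : ℤ → Spinor)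
    (m : ℕ) : walk a γ g δ m w =
      splitWalk (fun x => op (pauliDot (a x))) (op γ) (fun v => g (quadForm γ v)) δ w m := by
  induction m with
  | zero => rfl
  | succ m ih =>
    rw [walk, splitWalk, ih]
    congr 1
    funext n
    rw [coin, nonlinearCoin, act_exp, mul_assoc, ← Complex.ofReal_mul, act_exp, splitStep]

theorem splitWalk_congr {H : Spinor → ℝ} {R : ℝ} (hGH : ∀ v, ‖v‖ ≤ R → G v = H v) {m : ℕ}
    (hw : ∀ k < m, ∀ n, ‖splitWalk A Γ G δ w k n‖ ≤ R) :
    splitWalk A Γ G δ w m = splitWalk A Γ H δ w m := by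
  induction m with
  | zero => rfl
  | succ m ih =>
    rw [splitWalk, splitWalk, ← ih fun k hk => hw k (by omega)]
    congr 1
    funext n
    rw [splitStep, splitStep, hGH _ (hw m (by omega) n)]

/-- One step of the walk, as a map of `L²`. It maps step functions to step functions. -/
def walkStep (A : ℝ → Spinor →L[ℂ] Spinor) (Γ : Spinor →L[ℂ] Spinor) (G : Spinor → ℝ) (δ : ℝ)
    (f : L2) : L2 :=
  transport δ (superposition (localStep A Γ G δ) f)

theorem summable_norm_sq_splitStep (hA : IsTameField A C) (hΓ : IsSelfAdjoint Γ)
    (hw : Summable fun n => ‖w n‖ ^ 2) :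
    Summable fun n : ℤ => ‖splitStep (A (δ * n)) Γ G δ (w n)‖ ^ 2 := by
  simpa only [norm_splitStep (hA.isSelfAdjoint _) hΓ] using hw

theorem summable_norm_sq_splitWalk (hA : IsTameField A C) (hΓ : IsSelfAdjoint Γ)
    (hw : Summable fun n => ‖w n‖ ^ 2) (m : ℕ) :
    Summable fun n => ‖splitWalk A Γ G δ w m n‖ ^ 2 := by
  induction m with
  | zero => exact hw
  | succ m ih => exact summable_norm_sq_shift (summable_norm_sq_splitStep hA hΓ ih)

theorem walkStep_step (hA : IsTameField A C) (hΓ : IsSelfAdjoint Γ) (hG : IsTame G K)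
    (hδ : 0 < δ) (hw : Summable fun n => ‖w n‖ ^ 2) :
    walkStep A Γ G δ (step δ w)
      = step δ (shift fun n => splitStep (A (δ * n)) Γ G δ (w n)) := by
  have hsplit := summable_norm_sq_splitStep (G := G) (δ := δ) hA hΓ hw
  rw [walkStep, ← transport_step hδ hsplit]
  congr 1
  ext1
  filter_upwards [coeFn_superposition_localStep hA hΓ hG hδ.le (step δ w), coeFn_step hδ hw,
    coeFn_step hδ hsplit] with x h1 h2 h3
  rw [h1, h2, h3, localStep]

theorem step_splitWalk_succ (hA : IsTameField A C) (hΓ : IsSelfAdjoint Γ) (hG : IsTame G K)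
    (hδ : 0 < δ) (hw : Summable fun n => ‖w n‖ ^ 2) (m : ℕ) :
    step δ (splitWalk A Γ G δ w (m + 1)) = walkStep A Γ G δ (step δ (splitWalk A Γ G δ w m)) :=
  (walkStep_step hA hΓ hG hδ (summable_norm_sq_splitWalk hA hΓ hw m)).symm

theorem norm_walkStep_sub_le (hA : IsTameField A C) (hΓ : IsSelfAdjoint Γ) (hG : IsTame G K)
    (hδ : 0 ≤ δ) (f g : L2) :
    ‖walkStep A Γ G δ f - walkStep A Γ G δ g‖ ≤ (1 + K * ‖Γ‖ * δ) * ‖f - g‖ := by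
  rw [walkStep, walkStep, ← map_sub, norm_transport, mul_comm _ δ]
  exact norm_superposition_localStep_sub_le hA hΓ hG hδ f g

theorem norm_step_splitWalk (hA : IsTameField A C) (hΓ : IsSelfAdjoint Γ) (hδ : 0 < δ)
    (hw : Summable fun n => ‖w n‖ ^ 2) (m : ℕ) :
    ‖step δ (splitWalk A Γ G δ w m)‖ = ‖step δ w‖ := by
  induction m with
  | zero => rfl
  | succ m ih =>
    have hwalk := summable_norm_sq_splitWalk (G := G) (δ := δ) hA hΓ hw m
    have hsplit := summable_norm_sq_splitStep (G := G) (δ := δ) hA hΓ hwalk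
    rw [splitWalk, ← transport_step hδ hsplit, norm_transport, ← ih,
      ← sq_eq_sq₀ (norm_nonneg _) (norm_nonneg _), norm_sq_step hδ hsplit, norm_sq_step hδ hwalk]
    simp only [norm_splitStep (hA.isSelfAdjoint _) hΓ]

theorem norm_translate_walkStep_sub_le (hA : IsTameField A C) (hΓ : IsSelfAdjoint Γ)
    (hG : IsTame G K) (hδ : 0 < δ) (f : L2) :
    ‖translate δ (walkStep A Γ G δ f) - walkStep A Γ G δ f‖
      ≤ (1 + K * ‖Γ‖ * δ) * ‖translate δ f - f‖ + C * δ ^ 2 * ‖f‖ := by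
  rw [walkStep, ← transport_translate, ← map_sub, norm_transport, mul_comm _ δ]
  exact norm_translate_superposition_localStep_sub_le hA hΓ hG hδ f

theorem norm_translate_step_splitWalk_sub_le (hA : IsTameField A C) (hΓ : IsSelfAdjoint Γ)
    (hG : IsTame G K) (hδ : 0 < δ) {f f' : L2} (hf : IsWeakDeriv 1 f f') {T : ℝ} {m : ℕ}
    (hm : δ * m ≤ T) :
    ‖translate δ (step δ (splitWalk A Γ G δ (shannonInv δ f) m))
        - step δ (splitWalk A Γ G δ (shannonInv δ f) m)‖
      ≤ Real.exp (K * ‖Γ‖ * T) * (‖f'‖ + T * (C * ‖f‖)) * δ := by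
  let F (k : ℕ) : L2 := step δ (splitWalk A Γ G δ (shannonInv δ f) k)
  have hC := hA.nonneg
  have hK := hG.nonneg
  have : 0 ≤ T := le_trans (by positivity) hm
  have hw := summable_norm_sq_shannonInv hδ f
  have hF (k : ℕ) : ‖F k‖ ≤ ‖f‖ :=
    (norm_step_splitWalk hA hΓ hδ hw k).trans_le (norm_sample_le hδ f)
  have hsucc (k : ℕ) : ‖translate δ (F (k + 1)) - F (k + 1)‖
      ≤ (1 + K * ‖Γ‖ * δ) * ‖translate δ (F k) - F k‖ + δ * (C * δ * ‖f‖) := by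
    have hstep : F (k + 1) = walkStep A Γ G δ (F k) := step_splitWalk_succ hA hΓ hG hδ hw k
    calc ‖translate δ (F (k + 1)) - F (k + 1)‖
        ≤ (1 + K * ‖Γ‖ * δ) * ‖translate δ (F k) - F k‖ + C * δ ^ 2 * ‖F k‖ := by
          rw [hstep]
          exact norm_translate_walkStep_sub_le hA hΓ hG hδ (F k)
      _ ≤ (1 + K * ‖Γ‖ * δ) * ‖translate δ (F k) - F k‖ + C * δ ^ 2 * ‖f‖ := by
          gcongr
          exact hF k
      _ = (1 + K * ‖Γ‖ * δ) * ‖translate δ (F k) - F k‖ + δ * (C * δ * ‖f‖) := by ring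
  calc ‖translate δ (F m) - F m‖
      ≤ Real.exp (K * ‖Γ‖ * (δ * m)) * (‖translate δ (F 0) - F 0‖ + δ * m * (C * δ * ‖f‖)) :=
        le_exp_mul_of_succ_le (e := fun k => ‖translate δ (F k) - F k‖) (by positivity) hδ.le
          (by positivity) (norm_nonneg _) (fun k _ => hsucc k) m le_rfl
    _ ≤ Real.exp (K * ‖Γ‖ * T) * (‖f'‖ * δ + T * (C * δ * ‖f‖)) := by
        gcongr
        exact hf.norm_translate_sample_sub_le hδ
    _ = Real.exp (K * ‖Γ‖ * T) * (‖f'‖ + T * (C * ‖f‖)) * δ := by ring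

variable {T : ℝ} {u u' : ℝ → L2}

theorem eventually_norm_walkStep_sub_le (hA : IsTameField A C) (hΓ : IsSelfAdjoint Γ)
    (hG : IsTame G K) (hu' : ∀ t ∈ Set.Icc 0 T, IsWeakDeriv 1 (u t) (u' t))
    (hu : ∀ t ∈ Set.Icc 0 T, HasDerivWithinAt u (-sigmaThree (u' t)
      - Complex.I • superposition (fun x => potential (A x) Γ G) (u t)) (Set.Icc 0 T) t)
    {ε : ℝ} (hε : 0 < ε) : ∀ᶠ δ : ℝ in 𝓝[>] 0, ∀ t, 0 ≤ t → t + δ ≤ T →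
      ‖walkStep A Γ G δ (u t) - u (t + δ)‖ ≤ ε * δ := by
  have hcont : ContinuousOn u (Set.Icc 0 T) := fun t ht => (hu t ht).continuousWithinAt
  obtain ⟨U, hU⟩ := (isCompact_Icc.image_of_continuousOn hcont).isBounded.exists_norm_le
  let P (f : L2) : L2 := superposition (fun x => potential (A x) Γ G) f
  let D := (C + K * ‖Γ‖) ^ 2 + C
  have hlim : Tendsto (fun δ => δ * (D * U)) (𝓝[>] 0) (𝓝 0) := by
    simpa only [id_eq, zero_mul] using
      (tendsto_nhdsWithin_of_tendsto_nhds (a := (0 : ℝ)) tendsto_id).mul_const (D * U)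
  filter_upwards [self_mem_nhdsWithin, hlim.eventually_le_const (half_pos hε),
    eventually_norm_transport_neg_sub_euler_le
      ((continuous_superposition_potential hA Γ hG).comp_continuousOn hcont) hu' hu (half_pos hε)]
    with δ (hδ : 0 < δ) hδ_small hduhamel t ht htδ
  have hC := hA.nonneg
  have heuler : ‖superposition (localStep A Γ G δ) (u t) - (u t - (δ * Complex.I : ℂ) • P (u t))‖
      ≤ δ ^ 2 * D * U :=
    (norm_superposition_localStep_sub_euler_le hA hΓ hG hδ (u t)).trans
      (by gcongr; exact hU _ ⟨t, ⟨ht, by linarith⟩, rfl⟩)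
  have hback : u (t + δ) = transport δ (transport (-δ) (u (t + δ))) := by
    rw [transport_transport, add_neg_cancel, transport_zero]
  calc ‖walkStep A Γ G δ (u t) - u (t + δ)‖
      = ‖superposition (localStep A Γ G δ) (u t) - transport (-δ) (u (t + δ))‖ := by
        rw [walkStep, hback, ← map_sub, norm_transport, ← hback]
    _ ≤ δ ^ 2 * D * U + ε / 2 * δ := by
        refine (norm_sub_le_norm_sub_add_norm_sub _ _ _).trans (add_le_add heuler ?_)
        rw [norm_sub_rev]
        exact hduhamel t ht htδ
    _ = δ * (D * U) * δ + ε / 2 * δ := by ring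
    _ ≤ ε / 2 * δ + ε / 2 * δ := by gcongr
    _ = ε * δ := by ring

theorem eventually_norm_step_splitWalk_sub_le (hA : IsTameField A C) (hΓ : IsSelfAdjoint Γ)
    (hG : IsTame G K) (hT : 0 ≤ T) (hu' : ∀ t ∈ Set.Icc 0 T, IsWeakDeriv 1 (u t) (u' t))
    (hu : ∀ t ∈ Set.Icc 0 T, HasDerivWithinAt u (-sigmaThree (u' t)
      - Complex.I • superposition (fun x => potential (A x) Γ G) (u t)) (Set.Icc 0 T) t)
    {ε : ℝ} (hε : 0 < ε) : ∀ᶠ δ : ℝ in 𝓝[>] 0, ∀ m : ℕ, δ * m ≤ T →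
      ‖step δ (splitWalk A Γ G δ (shannonInv δ (u 0)) m) - u (m * δ)‖ ≤ ε := by
  have hK := hG.nonneg
  let D := Real.exp (K * ‖Γ‖ * T) * (1 + T)
  have hD : 0 < D := by positivity
  filter_upwards [self_mem_nhdsWithin,
    eventually_norm_walkStep_sub_le hA hΓ hG hu' hu (div_pos hε hD),
    eventually_norm_sample_sub_le (isCompact_singleton (x := u 0)) (div_pos hε hD)]
    with δ (hδ : 0 < δ) hconsistent hsample m hm
  have hw := summable_norm_sq_shannonInv hδ (u 0)
  let F (k : ℕ) : L2 := step δ (splitWalk A Γ G δ (shannonInv δ (u 0)) k)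
  have hsucc (k : ℕ) (hk : k < m) : ‖F (k + 1) - u ((k + 1 : ℕ) * δ)‖
      ≤ (1 + K * ‖Γ‖ * δ) * ‖F k - u (k * δ)‖ + δ * (ε / D) := by
    have htime : ((k + 1 : ℕ) : ℝ) * δ = k * δ + δ := by push_cast; ring
    have hle : k * δ + δ ≤ T := by
      rw [← htime, mul_comm]
      exact le_trans (by gcongr; exact hk) hm
    have hstep : F (k + 1) = walkStep A Γ G δ (F k) := step_splitWalk_succ hA hΓ hG hδ hw k
    rw [hstep, htime, mul_comm δ]
    exact (norm_sub_le_norm_sub_add_norm_sub _ (walkStep A Γ G δ (u (k * δ))) _).trans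
      (add_le_add (norm_walkStep_sub_le hA hΓ hG hδ.le _ _)
        (hconsistent _ (by positivity) hle))
  have hinit : ‖F 0 - u ((0 : ℕ) * δ)‖ ≤ ε / D := by
    rw [Nat.cast_zero, zero_mul]
    exact hsample (u 0) rfl
  calc ‖F m - u (m * δ)‖
      ≤ Real.exp (K * ‖Γ‖ * (δ * m)) * (‖F 0 - u ((0 : ℕ) * δ)‖ + δ * m * (ε / D)) :=
        le_exp_mul_of_succ_le (e := fun k : ℕ => ‖F k - u (k * δ)‖) (by positivity) hδ.le
          (by positivity) (norm_nonneg _) hsucc m le_rfl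
    _ ≤ Real.exp (K * ‖Γ‖ * T) * (ε / D + T * (ε / D)) := by gcongr
    _ = ε / D * D := by ring
    _ = ε := div_mul_cancel₀ ε hD.ne'

end SplitWalk

theorem eventually_norm_splitWalk_le {A : ℝ → Spinor →L[ℂ] Spinor} {Γ : Spinor →L[ℂ] Spinor}
    {G : Spinor → ℝ} {C K : ℝ} (hA : IsTameField A C) (hΓ : IsSelfAdjoint Γ) (hG : IsTame G K)
    {T : ℝ} (hT : 0 ≤ T) {u u' : ℝ → L2} (hu' : ∀ t ∈ Set.Icc 0 T, IsWeakDeriv 1 (u t) (u' t))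
    (hu : ∀ t ∈ Set.Icc 0 T, HasDerivWithinAt u (-sigmaThree (u' t)
      - Complex.I • superposition (fun x => potential (A x) Γ G) (u t)) (Set.Icc 0 T) t)
    {R : ℝ} (hR : ∀ t ∈ Set.Icc 0 T, ∀ᵐ x, ‖u t x‖ ≤ R) {c : ℝ} (hc : 0 < c) :
    ∀ᶠ δ : ℝ in 𝓝[>] 0, ∀ m : ℕ, δ * m ≤ T →
      ∀ n, ‖splitWalk A Γ G δ (shannonInv δ (u 0)) m n‖ ≤ R + c := by
  have hC := hA.nonneg
  have := hG.nonneg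
  let M := Real.exp (K * ‖Γ‖ * T) * (‖u' 0‖ + T * (C * ‖u 0‖))
  have : 0 ≤ M := by positivity
  obtain ⟨r, hr, hMr⟩ : ∃ r > 0, M * r ≤ c / 2 :=
    ⟨c / 2 / (M + 1), by positivity, by
      rw [mul_div_left_comm]
      exact mul_le_of_le_one_right (by positivity)
        (div_le_one_of_le₀ (by linarith) (by positivity))⟩
  filter_upwards [self_mem_nhdsWithin, eventually_norm_step_splitWalk_sub_le hA hΓ hG hT hu' hu
    (show 0 < c / 4 * r by positivity)] with δ (hδ : 0 < δ) hclose m hm n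
  have hw := summable_norm_sq_shannonInv hδ (u 0)
  have hmT : m * δ ∈ Set.Icc 0 T := ⟨by positivity, by rwa [mul_comm]⟩
  have hlt : ‖step δ (splitWalk A Γ G δ (shannonInv δ (u 0)) m) - u (m * δ)‖
      < c / 2 * √(r ^ 2) := by
    rw [Real.sqrt_sq hr.le]
    exact (hclose m hm).trans_lt (by gcongr; norm_num)
  have hle := norm_apply_le_of_norm_step_sub_lt hδ (summable_norm_sq_splitWalk hA hΓ hw m)
    (half_pos hc).le (by positivity)
    (norm_translate_step_splitWalk_sub_le hA hΓ hG hδ (hu' 0 ⟨le_rfl, hT⟩) hm) (hR _ hmT) hlt n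
  rw [Real.sqrt_sq hr.le] at hle
  linarith

theorem norm_shannon_sub_le {δ : ℝ} (hδ : 0 < δ) {w : ℤ → Spinor}
    (hw : Summable fun n => ‖w n‖ ^ 2) (f : L2) :
    ‖shannon δ w - f‖ ≤ ‖step δ w - f‖ + ‖sample δ f - f‖ + ‖bandProj δ f - f‖ := by
  calc ‖shannon δ w - f‖ ≤ ‖shannon δ w - bandProj δ f‖ + ‖bandProj δ f - f‖ :=
        norm_sub_le_norm_sub_add_norm_sub _ _ _
    _ = ‖step δ w - sample δ f‖ + ‖bandProj δ f - f‖ := by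
        rw [← shannon_shannonInv hδ, norm_shannon_sub hδ hw (summable_norm_sq_shannonInv hδ f),
          sample]
    _ ≤ ‖step δ w - f‖ + ‖sample δ f - f‖ + ‖bandProj δ f - f‖ := by
        gcongr
        rw [norm_sub_rev (sample δ f)]
        exact norm_sub_le_norm_sub_add_norm_sub _ _ _

/-! ### Solutions of the Dirac equation -/

theorem norm_weakDeriv_le_sobolevNorm {j k : ℕ} (hj : j ≤ k) (f : L2) :
    ‖weakDeriv j f‖ ≤ sobolevNorm k f :=
  Real.le_sqrt_of_sq_le <| Finset.single_le_sum (f := fun j => ‖weakDeriv j f‖ ^ 2)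
    (fun _ _ => by positivity) (Finset.mem_range_succ_iff.2 hj)

theorem sobolevNorm_mono {j k : ℕ} (hj : j ≤ k) (f : L2) : sobolevNorm j f ≤ sobolevNorm k f :=
  Real.sqrt_le_sqrt <| Finset.sum_le_sum_of_subset_of_nonneg
    (Finset.range_mono (Nat.succ_le_succ hj)) fun _ _ _ => by positivity

theorem MemH.mono {j k : ℕ} (hj : j ≤ k) {f : L2} (h : MemH k f) : MemH j f :=
  fun i hi => h i (hi.trans hj)

section DiracSolution

variable {s : ℕ} {a : ℝ → Coeff} {γ : Mat2} {g : ℝ → ℝ} {T : ℝ} {u₀ : L2} {u : ℝ → L2}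

theorem LipCondition.exists_isDiracSolution {L : ℝ} (h : LipCondition s a γ g T L)
    (hu₀ : MemH s u₀) (hu₀L : sobolevNorm s u₀ ≤ L) : ∃ u, IsDiracSolution s a γ g T u₀ u := by
  obtain ⟨_, _, hsol⟩ := h
  obtain ⟨u, _, hu, _⟩ := hsol u₀ u₀ hu₀ hu₀ hu₀L hu₀L
  exact ⟨u, hu⟩

namespace IsDiracSolution

theorem isWeakDeriv (hu : IsDiracSolution s a γ g T u₀ u) (hs : 1 ≤ s) {t : ℝ}
    (ht : t ∈ Set.Icc 0 T) : IsWeakDeriv 1 (u t) (weakDeriv 1 (u t)) :=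
  (hu.memH t ht).isWeakDeriv hs

theorem continuousOn_weakDeriv (hu : IsDiracSolution s a γ g T u₀ u) (hs : 1 ≤ s) :
    ContinuousOn (fun t => weakDeriv 1 (u t)) (Set.Icc 0 T) := by
  intro t₀ ht₀
  rw [ContinuousWithinAt, tendsto_iff_norm_sub_tendsto_zero]
  refine squeeze_zero' (Eventually.of_forall fun _ => norm_nonneg _) ?_ (hu.continuous t₀ ht₀)
  filter_upwards [self_mem_nhdsWithin] with t ht
  rw [← ((hu.isWeakDeriv hs ht).sub (hu.isWeakDeriv hs ht₀)).weakDeriv_eq]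
  exact norm_weakDeriv_le_sobolevNorm hs _

theorem continuousOn (hu : IsDiracSolution s a γ g T u₀ u) : ContinuousOn u (Set.Icc 0 T) :=
  fun t ht => (hu.equation t ht).choose_spec.1.continuousWithinAt

theorem exists_ae_norm_le (hu : IsDiracSolution s a γ g T u₀ u) (hs : 1 ≤ s) :
    ∃ R, ∀ t ∈ Set.Icc 0 T, ∀ᵐ x, ‖u t x‖ ≤ R := by
  obtain ⟨R, hR⟩ := isCompact_Icc.exists_bound_of_continuousOn hu.continuousOn
  obtain ⟨R', hR'⟩ := isCompact_Icc.exists_bound_of_continuousOn (hu.continuousOn_weakDeriv hs)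
  refine ⟨R + 1 + R', fun t ht => (hu.isWeakDeriv hs ht).ae_norm_le.mono fun x hx => ?_⟩
  linarith [hR t ht, hR' t ht]

theorem hasDerivWithinAt (hu : IsDiracSolution s a γ g T u₀ u) {C K R : ℝ}
    (hA : IsTameField (fun x => op (pauliDot (a x))) C) {G : Spinor → ℝ} (hG : IsTame G K)
    (hGg : ∀ v, ‖v‖ ≤ R → G v = g (quadForm γ v)) {t : ℝ} (ht : t ∈ Set.Icc 0 T)
    (hR : ∀ᵐ x, ‖u t x‖ ≤ R) :
    HasDerivWithinAt u (-sigmaThree (weakDeriv 1 (u t)) - Complex.I •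
      superposition (fun x => potential (op (pauliDot (a x))) (op γ) G) (u t)) (Set.Icc 0 T) t := by
  obtain ⟨w, hw, hequation⟩ := hu.equation t ht
  refine hw.congr_deriv ?_
  let P := superposition (fun x => potential (op (pauliDot (a x))) (op γ) G) (u t)
  ext1
  filter_upwards [hequation, hR, coeFn_sigmaThree (weakDeriv 1 (u t)),
    coeFn_superposition_potential hA (op γ) hG (u t),
    Lp.coeFn_sub (-sigmaThree (weakDeriv 1 (u t))) (Complex.I • P),
    Lp.coeFn_neg (sigmaThree (weakDeriv 1 (u t))), Lp.coeFn_smul Complex.I P]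
    with x heq hx hsigma hP hsub hneg hsmul
  have hw_eq : w x = -Complex.I • Complex.I • w x := by
    rw [smul_smul, neg_mul, Complex.I_mul_I, neg_neg, one_smul]
  have hP_eq : P x = act (pauliDot (a x)) (u t x)
      + (g (quadForm γ (u t x)) : ℂ) • act γ (u t x) := by
    rw [hP, potential, hGg _ hx]
    rfl
  rw [hsub, Pi.sub_apply, hneg, Pi.neg_apply, hsmul, Pi.smul_apply, hsigma, hP_eq, hw_eq, heq,
    add_assoc, smul_add, smul_smul, neg_mul_neg, Complex.I_mul_I, neg_one_smul, neg_smul,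
    sub_eq_add_neg]

theorem eventually_norm_shannon_walk_sub_le (hu : IsDiracSolution s a γ g T u₀ u) (hs : 1 ≤ s)
    (hT : 0 ≤ T) (ha_bdd : ∃ M : ℝ, ∀ x, ‖a x‖ ≤ M) (ha_lip : ∃ C, LipschitzWith C a)
    (hγ : γ.IsHermitian) (hg : ContDiff ℝ 1 g) {ε : ℝ} (hε : 0 < ε) :
    ∀ᶠ δ : ℝ in 𝓝[>] 0, ∀ m : ℕ, δ * m ≤ T →
      ‖shannon δ (walk a γ g δ m (shannonInv δ (bandProj δ u₀))) - u (m * δ)‖ ≤ ε := by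
  obtain ⟨R, hR⟩ := hu.exists_ae_norm_le hs
  obtain ⟨C, hA⟩ := exists_isTameField_op_pauliDot ha_bdd ha_lip
  obtain ⟨G, K, hG, hGg⟩ := exists_isTame_eq_of_norm_le (R := |R| + 1)
    (hg.comp ((contDiff_quadForm γ).of_le (by simp))) (by positivity)
  have hΓ := isSelfAdjoint_op hγ
  have hR_lt : R + 1 ≤ |R| + 1 := by gcongr; exact le_abs_self R
  have hderiv (t : ℝ) (ht : t ∈ Set.Icc 0 T) := hu.hasDerivWithinAt hA hG hGg ht
    ((hR t ht).mono fun x hx => hx.trans ((lt_add_one R).le.trans hR_lt))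
  have hweak (t : ℝ) (ht : t ∈ Set.Icc 0 T) := hu.isWeakDeriv hs ht
  have hcompact := isCompact_Icc.image_of_continuousOn hu.continuousOn
  have hε3 : 0 < ε / 3 := by positivity
  filter_upwards [self_mem_nhdsWithin,
    eventually_norm_splitWalk_le hA hΓ hG hT hweak hderiv hR one_pos,
    eventually_norm_step_splitWalk_sub_le hA hΓ hG hT hweak hderiv hε3,
    eventually_norm_sample_sub_le hcompact hε3, eventually_norm_bandProj_sub_le hcompact hε3]
    with δ (hδ : 0 < δ) hbound hclose hsample hband m hm
  have hmT : m * δ ∈ Set.Icc 0 T := ⟨by positivity, by rwa [mul_comm]⟩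
  have hwalk : walk a γ g δ m (shannonInv δ (bandProj δ u₀))
      = splitWalk (fun x => op (pauliDot (a x))) (op γ) G δ (shannonInv δ (u 0)) m := by
    rw [shannonInv_bandProj, walk_eq_splitWalk, hu.initial]
    refine (splitWalk_congr hGg fun k hk n => (hu.initial ▸ hbound k ?_ n).trans hR_lt).symm
    exact le_trans (by gcongr) hm
  rw [hwalk]
  refine (norm_shannon_sub_le hδ
    (summable_norm_sq_splitWalk hA hΓ (summable_norm_sq_shannonInv hδ (u 0)) m) _).trans ?_
  linarith [hclose m hm, hsample _ ⟨_, hmT, rfl⟩, hband _ ⟨_, hmT, rfl⟩]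

end IsDiracSolution

end DiracSolution

end NLQW

end

theorem mainTheorem2_general {s : ℕ} (hs : 1 ≤ s) {T : ℝ} (hT : 0 ≤ T) {a : ℝ → Coeff}
    (ha_bdd : ∃ M : ℝ, ∀ x, ‖a x‖ ≤ M) (ha_lip : ∃ C, LipschitzWith C a) {γ : Mat2}
    (hγ : γ.IsHermitian) {g : ℝ → ℝ} (hg : ContDiff ℝ 1 g) {u₀ : L2} {u : ℝ → L2}
    (hu : IsDiracSolution s a γ g T u₀ u) :
    Tendsto
      (fun δ : ℝ => ⨆ (m : ℕ) (_ : δ * m ≤ T),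
        ‖shannon δ (walk a γ g δ m (shannonInv δ (bandProj δ u₀))) - u (m * δ)‖ₑ)
      (𝓝[>] 0) (𝓝 0) := by
  refine ENNReal.tendsto_nhds_zero.2 fun ε hε => ?_
  rcases eq_or_ne ε ⊤ with rfl | hε_top
  · exact Eventually.of_forall fun _ => le_top
  filter_upwards [hu.eventually_norm_shannon_walk_sub_le hs hT ha_bdd ha_lip hγ hg
    (ENNReal.toReal_pos hε.ne' hε_top)] with δ hδ
  refine iSup₂_le fun m hm => ?_
  rw [← ofReal_norm]
  exact ENNReal.ofReal_le_of_le_toReal (hδ m hm)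

theorem mainTheorem2 (s : ℕ) (hs : 1 ≤ s) (T L : ℝ) (hT : 0 < T) (hL : 0 < L)
    (a : ℝ → Coeff) (ha : ContDiff ℝ ∞ a) (ha_bdd : ∃ M : ℝ, ∀ x, ‖a x‖ ≤ M)
    (ha_deriv : ∀ j ≤ s, MemLp (iteratedDeriv j (deriv a)) 2 volume)
    (γ : Mat2) (hγ : γ.IsHermitian) (g : ℝ → ℝ) (hg : ContDiff ℝ ∞ g)
    (hLip : LipCondition s a γ g T L)
    (u₀ : L2) (hu₀ : MemH (s + 1) u₀) (hu₀L : sobolevNorm (s + 1) u₀ ≤ L) :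
    (∃ u : ℝ → L2, IsDiracSolution s a γ g T u₀ u) ∧
    ∀ u : ℝ → L2, IsDiracSolution s a γ g T u₀ u →
      Tendsto
        (fun δ : ℝ => ⨆ (m : ℕ) (_ : δ * m ≤ T),
          ‖shannon δ (walk a γ g δ m (shannonInv δ (bandProj δ u₀))) - u (m * δ)‖ₑ)
        (𝓝[>] 0) (𝓝 0) := by
  have ha_lip := exists_lipschitzWith_of_memLp_deriv (contDiff_infty.1 ha 2)
    (by simpa using ha_deriv 0 (Nat.zero_le s)) (by simpa using ha_deriv 1 hs)
  exact ⟨hLip.exists_isDiracSolution (hu₀.mono s.le_succ)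
      ((sobolevNorm_mono s.le_succ u₀).trans hu₀L),
    fun u hu => mainTheorem2_general hs hT.le ha_bdd ha_lip hγ (contDiff_infty.1 hg 1) hu⟩
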